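/- **Theorem.** All graphs are finite, simple and undirected, and classes of graphs are closed under isomorphism. Let $r \ge 3$ and $k \in \mathbb{N}$. For $n\in\mathbb N$, the *$r$-biclique of order $n$* is the $r$-subdivision of the complete bipartite graph $K_{n,n}$, i.e. the graph obtained from $K_{n,n}$ by replacing every edge with a path of length $r+1$. A *$k$-flip* of a graph $G$ is a graph $G'$ on the vertex set $V(G)$ for which there are a colouring $\lambda\colon V(G)\to\{1,\dots,k\}$ and a symmetric relation $R\subseteq\{1,\dots,k\}^2$ such that, for all distinct $u,v\in V(G)$, $uv\in E(G')$ if and only if exactly one of $uv\in E(G)$ and $(\lambda(u),\lambda(v))\in R$ holds. Let $\mathscr C$ be a hereditary class of graphs (closed under induced subgraphs) that contains, for every $n$, some $k$-flip of the $r$-biclique of order $n$. Then $\mathscr C$ effectively interprets the class of all graphs using only existential formulas on singletons. That is, there are first-order formulas $\delta(x)$ and $\varphi(x,y)$ in the language of graphs (adjacency and equality) such that * both are existential (they contain no universal quantifier, and negation is applied only to quantifier-free subformulas), and $\varphi$ is symmetric and irreflexive in every graph; and * there is a polynomial-time algorithm which, given any graph $H$, computes a graph $G\in\mathscr C$, whose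 number of vertices is polynomially bounded in $|V(H)|$, such that the graph $I_{\delta,\varphi}(G)$ with vertex set $\{v\in V(G) : G\models\delta(v)\}$ and edge set $\{uv : u\ne v,\ G\models\delta(u)\wedge\delta(v)\wedge\varphi(u,v)\}$ is isomorphic to $H$. -/

import Mathlib

open FirstOrder

/-! ### Finite graphs and graph classes -/

/-- A finite simple graph on the vertex set `{0, …, n - 1}`. Every finite graph is isomorphic to
one of these, so an isomorphism-closed class of finite graphs is a set of them. -/
abbrev FinGraph : Type := Σ n : ℕ, SimpleGraph (Fin n)

/-- A class of graphs is hereditary if it is closed under induced subgraphs (and isomorphism):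
`H ↪g G` is the type of isomorphisms of `H` with an induced subgraph of `G`. -/
def IsHereditary (C : Set FinGraph) : Prop :=
  ∀ G ∈ C, ∀ H : FinGraph, Nonempty (H.2 ↪g G.2) → H ∈ C

/-- The class contains the graph `G` up to isomorphism. -/
def ClassContains (C : Set FinGraph) {V : Type} (G : SimpleGraph V) : Prop :=
  ∃ H ∈ C, Nonempty (H.2 ≃g G)

/-! ### Flips -/

/-- `G'` is a `k`-flip of `G`. -/
def IsFlip {V : Type} (k : ℕ) (G G' : SimpleGraph V) : Prop :=
  ∃ (col : V → Fin k) (R : Fin k → Fin k → Prop), (∀ i j, R i j → R j i) ∧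
    ∀ u v, u ≠ v → (G'.Adj u v ↔ Xor (G.Adj u v) (R (col u) (col v)))

/-! ### Subdivided bicliques -/

/-- Vertices of the `r`-subdivision of the complete bipartite graph with sides of size `n`:
the native vertices of either side, and, for each edge `(i, j)`, the `r` inner vertices of the path
of length `r + 1` that replaces it, in order from `left i` to `right j`. -/
inductive BicliqueVertex (r n : ℕ) : Type
  | left (i : Fin n) : BicliqueVertex r n
  | right (j : Fin n) : BicliqueVertex r n
  | inner (i j : Fin n) (p : Fin r) : BicliqueVertex r n

/-- One orientation of the edges: `x` is the vertex just before `y` on one of the paths. -/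
def BicliqueVertex.Next {r n : ℕ} : BicliqueVertex r n → BicliqueVertex r n → Prop
  | .left i, .inner i' _ p => i = i' ∧ (p : ℕ) = 0
  | .inner i j p, .inner i' j' q => i = i' ∧ j = j' ∧ (p : ℕ) + 1 = q
  | .inner _ j p, .right j' => j = j' ∧ (p : ℕ) + 1 = r
  | .left _, .right _ => r = 0
  | _, _ => False

/-- The `r`-biclique of order `n`: the `r`-subdivision of `K_{n,n}`. -/
def subdividedBiclique (r n : ℕ) : SimpleGraph (BicliqueVertex r n) :=
  SimpleGraph.fromRel BicliqueVertex.Next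

/-! ### Existential formulas and interpretations -/

/-- Existential formulas: no universal quantifier, and negation only in quantifier-free
subformulas. -/
inductive IsExistentialFormula {α : Type} :
    ∀ {n : ℕ}, Language.graph.BoundedFormula α n → Prop
  | of_isQF {n : ℕ} {φ : Language.graph.BoundedFormula α n} (h : φ.IsQF) :
      IsExistentialFormula φ
  | inf {n : ℕ} {φ ψ : Language.graph.BoundedFormula α n} (hφ : IsExistentialFormula φ)
      (hψ : IsExistentialFormula ψ) : IsExistentialFormula (φ ⊓ ψ)
  | sup {n : ℕ} {φ ψ : Language.graph.BoundedFormula α n} (hφ : IsExistentialFormula φ)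
      (hψ : IsExistentialFormula ψ) : IsExistentialFormula (φ ⊔ ψ)
  | ex {n : ℕ} {φ : Language.graph.BoundedFormula α (n + 1)} (h : IsExistentialFormula φ) :
      IsExistentialFormula φ.ex

/-- `G ⊨ φ(a)`. -/
def GraphSat {V : Type} (G : SimpleGraph V) {m : ℕ} (φ : Language.graph.Formula (Fin m))
    (a : Fin m → V) : Prop :=
  @Language.Formula.Realize Language.graph V G.structure (Fin m) φ a

/-- A (one-dimensional) interpretation: a domain formula `δ(x)` and an edge formula `φ(x, y)`,
where `φ` is symmetric and irreflexive in all (finite) graphs. -/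
structure Interpretation where
  δ : Language.graph.Formula (Fin 1)
  φ : Language.graph.Formula (Fin 2)
  irrefl : ∀ {V : Type} [Finite V] (G : SimpleGraph V) (u : V), ¬ GraphSat G φ ![u, u]
  symm : ∀ {V : Type} [Finite V] (G : SimpleGraph V) (u v : V),
    GraphSat G φ ![u, v] → GraphSat G φ ![v, u]

/-- The graph `I(G)`. -/
def Interpretation.apply (I : Interpretation) {V : Type} [Finite V] (G : SimpleGraph V) :
    SimpleGraph {v : V // GraphSat G I.δ ![v]} where
  Adj u v := GraphSat G I.φ ![u.1, v.1]
  symm := ⟨fun u v h => I.symm G u.1 v.1 h⟩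
  loopless := ⟨fun u h => I.irrefl G u.1 h⟩

/-- The interpretation is existential. -/
def Interpretation.IsExistential (I : Interpretation) : Prop :=
  IsExistentialFormula I.δ ∧ IsExistentialFormula I.φ

/-! ### Effective interpretations -/

open Classical in
/-- The adjacency matrix of a graph as a string: the `0`-`1` rows in order, each of them followed
by the end-of-row symbol `none`. -/
noncomputable def encodeGraph (G : FinGraph) : List (Option Bool) :=
  (List.finRange G.1).flatMap fun i =>
    ((List.finRange G.1).map fun j => some (decide (G.2.Adj i j))) ++ [none]

/-- `C` effectively existentially interprets `D`: for some existential interpretation `I`, some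
map that a Turing machine computes in polynomial time takes each `H ∈ D` to a graph `G ∈ C` of size
polynomial in `|V(H)|` with `I(G)` (isomorphic to) `H`. -/
def EffectivelyExistentiallyInterprets (C D : Set FinGraph) : Prop :=
  ∃ I : Interpretation, I.IsExistential ∧
    ∃ f : {H : FinGraph // H ∈ D} → FinGraph,
      Nonempty (Turing.TM2ComputableInPolyTime (fun H => encodeGraph H.1) encodeGraph f) ∧
      (∃ p : Polynomial ℕ, ∀ H, (f H).1 ≤ p.eval H.1.1) ∧
      ∀ H, f H ∈ C ∧ Nonempty (I.apply (f H).2 ≃g H.1.2)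

/-!
By Ramsey's theorem, the class contains, for some relation `R` on the layers of the bicliques (the
positions on their subdivided edges), the flips along `R` of all bicliques. Call the bicliques
before these flips the hosts.

Encode a graph `H` by a gadget graph: each vertex becomes a hub with three leaves, and each edge
becomes two arms that lead from its two ends to a common middle vertex. This is an induced subgraph
of a host in which only the hubs have degree at least three. Add many disjoint copies of the
biclique of order `2`, and flip along `R`. Then every induced embedding into a flipped host
preserves the adjacency before the flips: by the pigeonhole principle, it sends six of the copies to
the same layers, and if these layers were not equivalent to the original ones with respect to `R`,
there would be two adjacent vertices of degree at least three in a host, whereas the native vertices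
of a host are not adjacent. So induced embeddings of gadget graphs into each other send hubs to
hubs. Hence a vertex is a hub, and two vertices are the hubs of adjacent vertices of `H`, if and
only if they are the hubs in an induced copy of the gadget graph of the complete graph on one or two
vertices, respectively.

A vertex of the gadget graph is a pair of a position in the adjacency matrix of `H` and one of
finitely many kinds, and the adjacency of two such vertices depends only on their kinds, on the
entries of the matrix, and on which of the indices of their positions are equal. So a machine that
sweeps over the matrix with marks for these equalities prints the gadget graph in polynomial time.
-/

/-! ### Existential formulas describing rooted induced subgraphs -/

section PatternFormula

open Language

variable {α : Type} {n N c : ℕ}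

lemma isQF_iInf {L : Language} {β : Type} [Finite β] {f : β → L.BoundedFormula α n}
    (h : ∀ b, (f b).IsQF) : (BoundedFormula.iInf f).IsQF := by
  have isQF_foldr (l : List β) : ((l.map f).foldr (· ⊓ ·) ⊤).IsQF := by
    induction l with
    | nil => exact .top
    | cons b l ih => exact (h b).inf ih
  exact isQF_foldr _

lemma IsExistentialFormula.exs : ∀ {n : ℕ} {φ : Language.graph.BoundedFormula α n},
    IsExistentialFormula φ → IsExistentialFormula φ.exs
  | 0, _, h => h
  | _ + 1, φ, h => IsExistentialFormula.exs (φ := φ.ex) (.ex h)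

open Classical in
/-- The quantifier-free condition that the bound variables `u` and `v` are equal or distinct, and
adjacent or not, exactly as the vertices `u` and `v` of `P` are. -/
noncomputable def pairFormula (P : SimpleGraph (Fin N)) (u v : Fin N) :
    Language.graph.BoundedFormula (Fin c) N :=
  (if u = v then ⊤ else ∼(Term.bdEqual (&u) (&v))) ⊓
    (if P.Adj u v then adj.boundedFormula₂ (&u) (&v) else ∼(adj.boundedFormula₂ (&u) (&v)))

/-- The formula saying that `P` embeds as an induced subgraph with its roots `a` at the free
variables. -/
noncomputable def patternFormula (P : SimpleGraph (Fin N)) (a : Fin c → Fin N) :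
    Language.graph.Formula (Fin c) :=
  BoundedFormula.exs
    ((BoundedFormula.iInf fun uv : Fin N × Fin N => pairFormula P uv.1 uv.2) ⊓
      BoundedFormula.iInf fun i : Fin c => Term.bdEqual (Term.var (Sum.inl i)) (&(a i)))

lemma isQF_pairFormula (P : SimpleGraph (Fin N)) (u v : Fin N) :
    (pairFormula (c := c) P u v).IsQF := by
  have isQF_adj : (adj.boundedFormula₂ (&u) (&v) : Language.graph.BoundedFormula (Fin c) N).IsQF :=
    (BoundedFormula.IsAtomic.rel _ _).isQF
  refine .inf ?_ ?_
  · split_ifs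
    exacts [.top, (BoundedFormula.IsAtomic.equal _ _).isQF.not]
  · split_ifs
    exacts [isQF_adj, isQF_adj.not]

lemma isExistentialFormula_patternFormula (P : SimpleGraph (Fin N)) (a : Fin c → Fin N) :
    IsExistentialFormula (patternFormula P a) :=
  .exs (.of_isQF (.inf (isQF_iInf fun _ => isQF_pairFormula P _ _)
    (isQF_iInf fun _ => (BoundedFormula.IsAtomic.equal _ _).isQF)))

variable {V : Type} (G : SimpleGraph V) (x : Fin c → V)

lemma realize_pairFormula (P : SimpleGraph (Fin N)) (u v : Fin N) (y : Fin N → V) :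
    letI := G.structure
    (pairFormula (c := c) P u v).Realize x y ↔
      (u ≠ v → y u ≠ y v) ∧ (P.Adj u v ↔ G.Adj (y u) (y v)) := by
  let := G.structure
  have relMap_adj (w z : V) : Structure.RelMap adj ![w, z] ↔ G.Adj w z := Iff.rfl
  rw [pairFormula, BoundedFormula.realize_inf]
  refine and_congr ?_ ?_
  · split_ifs with h <;> simp [h]
  · split_ifs with h <;> simp [h, relMap_adj]

lemma graphSat_patternFormula (P : SimpleGraph (Fin N)) (a : Fin c → Fin N) :
    GraphSat G (patternFormula P a) x ↔ ∃ h : P ↪g G, ∀ i, h (a i) = x i := by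
  let := G.structure
  simp only [GraphSat, patternFormula, BoundedFormula.realize_exs, BoundedFormula.realize_inf,
    BoundedFormula.realize_iInf, realize_pairFormula, Prod.forall, BoundedFormula.realize_bdEqual,
    Term.realize_var, Sum.elim_inl]
  constructor
  · rintro ⟨y, hy, hx⟩
    have injective_y : y.Injective := fun u v huv => by_contra fun hne => (hy u v).1 hne huv
    exact ⟨⟨⟨y, injective_y⟩, (hy _ _).2.symm⟩, fun i => (hx i).symm⟩
  · rintro ⟨h, hx⟩
    exact ⟨h, fun u v => ⟨h.injective.ne, h.map_adj_iff.symm⟩, fun i => (hx i).symm⟩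

end PatternFormula

/-! ### Flips along labellings -/

section LabelFlip

variable {V W L L' : Type}

/-- The flip of `G` along a labelling of its vertices: adjacency is complemented between distinct
vertices whose labels form a pair in `R`. Unordered pairs of labels make the symmetry of the
relation automatic. -/
def labelFlip (G : SimpleGraph V) (lab : V → L) (R : Set (Sym2 L)) : SimpleGraph V where
  Adj u v := u ≠ v ∧ Xor (G.Adj u v) (s(lab u, lab v) ∈ R)
  symm := ⟨fun u v h => by rwa [ne_comm, G.adj_comm, Sym2.eq_swap]⟩
  loopless := ⟨fun _ h => h.1 rfl⟩

lemma labelFlip_adj {G : SimpleGraph V} {lab : V → L} {R : Set (Sym2 L)} {u v : V}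
    (huv : u ≠ v) : (labelFlip G lab R).Adj u v ↔ Xor (G.Adj u v) (s(lab u, lab v) ∈ R) :=
  and_iff_right huv

lemma IsFlip.exists_eq_labelFlip {k : ℕ} {G G' : SimpleGraph V} (h : IsFlip k G G') :
    ∃ (col : V → Fin k) (R : Set (Sym2 (Fin k))), G' = labelFlip G col R := by
  obtain ⟨col, R, hR, hG'⟩ := h
  refine ⟨col, Sym2.fromRel (r := R) ⟨hR⟩, ?_⟩
  ext u v
  by_cases huv : u = v
  · simp [huv]
  · rw [labelFlip_adj huv, hG' u v huv, Sym2.fromRel_prop]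

/-- An embedding of graphs that respects the labellings and the relations between the labels is an
embedding of the flips. -/
def labelFlipEmbedding {G : SimpleGraph V} {lab : V → L} {R : Set (Sym2 L)} {G' : SimpleGraph W}
    {lab' : W → L'} {R' : Set (Sym2 L')} (f : G ↪g G')
    (hf : ∀ u v, s(lab' (f u), lab' (f v)) ∈ R' ↔ s(lab u, lab v) ∈ R) :
    labelFlip G lab R ↪g labelFlip G' lab' R' where
  toEmbedding := f.toEmbedding
  map_rel_iff' {u v} := and_congr f.injective.ne_iff (by
    rw [RelEmbedding.coe_toEmbedding, f.map_adj_iff, hf])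

lemma adj_iff_adj_iff_mem_iff_mem {G : SimpleGraph V} {lab : V → L} {R : Set (Sym2 L)}
    {G' : SimpleGraph W} {lab' : W → L'} {R' : Set (Sym2 L')}
    (h : labelFlip G lab R ↪g labelFlip G' lab' R') {u v : V} (huv : u ≠ v) :
    (G.Adj u v ↔ G'.Adj (h u) (h v)) ↔
      (s(lab u, lab v) ∈ R ↔ s(lab' (h u), lab' (h v)) ∈ R') := by
  have := h.map_adj_iff (v := u) (w := v)
  rw [labelFlip_adj huv, labelFlip_adj (h.injective.ne huv)] at this
  unfold Xor at this
  tauto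

lemma adj_of_not_adj_of_not_mem_iff_mem {G : SimpleGraph V} {lab : V → L} {R : Set (Sym2 L)}
    {G' : SimpleGraph W} {lab' : W → L'} {R' : Set (Sym2 L')}
    (h : labelFlip G lab R ↪g labelFlip G' lab' R') {u v : V} (huv : u ≠ v) (hG : ¬ G.Adj u v)
    (hmem : ¬ (s(lab u, lab v) ∈ R ↔ s(lab' (h u), lab' (h v)) ∈ R')) : G'.Adj (h u) (h v) :=
  by_contra fun hG' => hmem ((adj_iff_adj_iff_mem_iff_mem h huv).1 (iff_of_false hG hG'))

end LabelFlip

/-! ### Layers of subdivided bicliques and Ramsey's theorem -/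

section Layers

variable {r n m k : ℕ}

instance : Finite (BicliqueVertex r n) := by
  let toSum : BicliqueVertex r n → (Fin n ⊕ Fin n) ⊕ (Fin n × Fin n × Fin r)
    | .left i => .inl (.inl i)
    | .right j => .inl (.inr j)
    | .inner i j p => .inr (i, j, p)
  refine Finite.of_injective toSum ?_
  rintro (i | i | ⟨i, j, p⟩) (i' | i' | ⟨i', j', p'⟩) h <;> simp_all [toSum]

/-- The position of a vertex on the paths of the subdivided biclique, from left to right. -/
def BicliqueVertex.layer : BicliqueVertex r n → Fin (r + 2)
  | .left _ => 0
  | .inner _ _ p => p.succ.castSucc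
  | .right _ => Fin.last _

lemma BicliqueVertex.layer_surjective [NeZero n] :
    Function.Surjective (layer : BicliqueVertex r n → Fin (r + 2)) := by
  intro l
  induction l using Fin.lastCases with
  | last => exact ⟨.right 0, rfl⟩
  | cast l =>
    induction l using Fin.cases with
    | zero => exact ⟨.left 0, rfl⟩
    | succ p => exact ⟨.inner 0 0 p, rfl⟩

/-- The flip of the subdivided biclique in which the pairs of layers in `R` are complemented. -/
abbrev layerFlip (R : Set (Sym2 (Fin (r + 2)))) (n : ℕ) : SimpleGraph (BicliqueVertex r n) :=
  labelFlip (subdividedBiclique r n) BicliqueVertex.layer R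

/-- The map of subdivided bicliques induced by maps of both sides. -/
def BicliqueVertex.map (f g : Fin n → Fin m) : BicliqueVertex r n → BicliqueVertex r m
  | .left i => .left (f i)
  | .right j => .right (g j)
  | .inner i j p => .inner (f i) (g j) p

lemma BicliqueVertex.map_injective {f g : Fin n → Fin m} (hf : f.Injective) (hg : g.Injective) :
    (BicliqueVertex.map (r := r) f g).Injective := by
  rintro (i | i | ⟨i, j, p⟩) (i' | i' | ⟨i', j', p'⟩) h <;>
    simp_all [BicliqueVertex.map, hf.eq_iff, hg.eq_iff]

lemma BicliqueVertex.next_map {f g : Fin n → Fin m} (hf : f.Injective) (hg : g.Injective)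
    (u v : BicliqueVertex r n) : (u.map f g).Next (v.map f g) ↔ u.Next v := by
  rcases u with (_ | _ | _) <;> rcases v with (_ | _ | _) <;>
    simp [BicliqueVertex.map, BicliqueVertex.Next, hf.eq_iff, hg.eq_iff]

lemma BicliqueVertex.layer_map (f g : Fin n → Fin m) (u : BicliqueVertex r n) :
    (u.map f g).layer = u.layer := by
  cases u <;> rfl

/-- The embedding of subdivided bicliques induced by embeddings of both sides. -/
def subdividedBicliqueEmbedding (f g : Fin n ↪ Fin m) :
    subdividedBiclique r n ↪g subdividedBiclique r m where
  toFun := BicliqueVertex.map f g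
  inj' := BicliqueVertex.map_injective f.injective g.injective
  map_rel_iff' {u v} := by
    simp [subdividedBiclique, BicliqueVertex.next_map f.injective g.injective,
      (BicliqueVertex.map_injective f.injective g.injective).eq_iff]

/-- Larger layer flips contain the smaller ones. -/
def layerFlipEmbedding (R : Set (Sym2 (Fin (r + 2)))) (h : n ≤ m) :
    layerFlip R n ↪g layerFlip R m :=
  labelFlipEmbedding (subdividedBicliqueEmbedding (Fin.castLEEmb h) (Fin.castLEEmb h))
    fun u v => by simp only [subdividedBicliqueEmbedding, RelEmbedding.coe_mk,
      Function.Embedding.coeFn_mk, BicliqueVertex.layer_map]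

lemma exists_embedding_fiber {α β : Type} [Finite α] [Finite β] [Nonempty β] (f : α → β)
    (h : Nat.card β * n ≤ Nat.card α) : ∃ (y : β) (g : Fin n ↪ α), ∀ i, f (g i) = y := by
  classical
  have := Fintype.ofFinite α
  have := Fintype.ofFinite β
  rw [Nat.card_eq_fintype_card, Nat.card_eq_fintype_card] at h
  obtain ⟨y, hy⟩ := Fintype.exists_le_card_fiber_of_mul_le_card f h
  obtain ⟨s, s_subset, card_s⟩ := Finset.exists_subset_card_eq hy
  let e := (s.equivFinOfCardEq card_s).symm
  exact ⟨y, e.toEmbedding.trans (.subtype _), fun i => (Finset.mem_filter.1 (s_subset (e i).2)).2⟩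

lemma exists_monochromatic_grid (κ : Type) [Finite κ] [Nonempty κ] (n : ℕ) :
    ∃ M : ℕ, ∀ c : Fin M → Fin M → κ,
      ∃ (f g : Fin n ↪ Fin M) (x : κ), ∀ i j, c (f i) (g j) = x := by
  -- Find `n` rows that agree on the first `t` columns, then `n` of these columns of one colour.
  let t := Nat.card κ * n
  let M := Nat.card (Fin t → κ) * n + t
  refine ⟨M, fun c => ?_⟩
  let col : Fin t ↪ Fin M := Fin.castLEEmb (Nat.le_add_left _ _)
  obtain ⟨row, f, hf⟩ := exists_embedding_fiber (n := n)
    (fun (i : Fin M) (j : Fin t) => c i (col j)) (by simp [M])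
  obtain ⟨x, g, hg⟩ := exists_embedding_fiber (n := n) row (by simp [t])
  exact ⟨f, g.trans col, x, fun i j => (congrFun (hf i) (g j)).trans (hg j)⟩

lemma exists_color_map_eq_layer (κ : Type) [Finite κ] [Nonempty κ] (r n : ℕ) :
    ∃ M : ℕ, ∀ col : BicliqueVertex r M → κ,
      ∃ (f g : Fin n ↪ Fin M) (c : Fin (r + 2) → κ),
        ∀ u : BicliqueVertex r n, col (u.map f g) = c u.layer := by
  obtain ⟨M, hM⟩ := exists_monochromatic_grid (κ × κ × (Fin r → κ)) n
  refine ⟨M, fun col => ?_⟩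
  obtain ⟨f, g, ⟨cl, cr, ci⟩, hfg⟩ :=
    hM fun i j => (col (.left i), col (.right j), fun p => col (.inner i j p))
  simp only [Prod.mk.injEq, funext_iff] at hfg
  refine ⟨f, g, Fin.snoc (Fin.cons cl ci : Fin (r + 1) → κ) cr, ?_⟩
  rintro (i | j | ⟨i, j, p⟩)
  · exact (hfg i i).1
  · exact (hfg j j).2.1.trans (by rw [BicliqueVertex.layer, Fin.snoc_last])
  · exact ((hfg i j).2.2 p).trans (by rw [BicliqueVertex.layer, Fin.snoc_castSucc, Fin.cons_succ])

lemma exists_layerFlip_mem {C : Set FinGraph} (hC : IsHereditary C)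
    (hflip : ∀ n : ℕ, ∃ G : SimpleGraph (BicliqueVertex r n),
      IsFlip k (subdividedBiclique r n) G ∧ ClassContains C G) (n : ℕ) :
    ∃ R : Set (Sym2 (Fin (r + 2))), ∀ H : FinGraph, Nonempty (H.2 ↪g layerFlip R n) → H ∈ C := by
  have nonempty_colors : Nonempty (Fin k) := by
    obtain ⟨_, ⟨col, _⟩, _⟩ := hflip 1
    exact ⟨col (.left 0)⟩
  obtain ⟨M, hM⟩ := exists_color_map_eq_layer (Fin k) r n
  obtain ⟨G, G_flip, G', G'_mem, ⟨iso⟩⟩ := hflip M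
  obtain ⟨col, R, rfl⟩ := G_flip.exists_eq_labelFlip
  obtain ⟨f, g, c, hc⟩ := hM col
  refine ⟨Sym2.map c ⁻¹' R, fun H ⟨e⟩ => hC G' G'_mem H ⟨?_⟩⟩
  have color_iff (u v : BicliqueVertex r n) :
      s(col (u.map f g), col (v.map f g)) ∈ R ↔ s(u.layer, v.layer) ∈ Sym2.map c ⁻¹' R := by
    rw [hc, hc, Set.mem_preimage, Sym2.map_mk]
  exact (e.trans (labelFlipEmbedding (subdividedBicliqueEmbedding f g) color_iff)).trans
    iso.symm.toRelEmbedding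

lemma exists_forall_layerFlip_mem {C : Set FinGraph} (hC : IsHereditary C)
    (hflip : ∀ n : ℕ, ∃ G : SimpleGraph (BicliqueVertex r n),
      IsFlip k (subdividedBiclique r n) G ∧ ClassContains C G) :
    ∃ R : Set (Sym2 (Fin (r + 2))),
      ∀ (n : ℕ) (H : FinGraph), Nonempty (H.2 ↪g layerFlip R n) → H ∈ C := by
  by_contra! hbad
  have := Fintype.ofFinite (Set (Sym2 (Fin (r + 2))))
  choose order H embeds not_mem using hbad
  obtain ⟨R, hR⟩ := exists_layerFlip_mem hC hflip (∑ R, order R)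
  have order_le : order R ≤ ∑ R, order R :=
    Finset.single_le_sum (fun _ _ => Nat.zero_le _) (Finset.mem_univ R)
  obtain ⟨e⟩ := embeds R
  exact not_mem R (hR _ ⟨e.trans (layerFlipEmbedding R order_le)⟩)

end Layers

/-! ### The structure of subdivided bicliques -/

section Biclique

variable {r n : ℕ}

lemma BicliqueVertex.not_next_self (u : BicliqueVertex r n) : ¬ u.Next u := by
  cases u <;> simp [BicliqueVertex.Next]

lemma subdividedBiclique_adj {u v : BicliqueVertex r n} :
    (subdividedBiclique r n).Adj u v ↔ u.Next v ∨ v.Next u := by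
  rw [subdividedBiclique, SimpleGraph.fromRel_adj, and_iff_right_iff_imp]
  rintro h rfl
  exact u.not_next_self (h.elim id id)

/-- The native vertices of a subdivided biclique are those on its two sides. -/
def BicliqueVertex.IsNative : BicliqueVertex r n → Prop
  | .inner _ _ _ => False
  | _ => True

lemma BicliqueVertex.next_unique {i j : Fin n} {p : Fin r} {u v : BicliqueVertex r n}
    (hu : (BicliqueVertex.inner i j p).Next u) (hv : (BicliqueVertex.inner i j p).Next v) :
    u = v := by
  rcases u with (_ | _ | ⟨i', j', p'⟩) <;> rcases v with (_ | _ | ⟨i'', j'', p''⟩) <;>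
    simp only [BicliqueVertex.Next] at hu hv
  · rw [← hu.1, ← hv.1]
  · omega
  · omega
  · obtain ⟨rfl, rfl, h⟩ := hu
    obtain ⟨rfl, rfl, h'⟩ := hv
    rw [Fin.ext (h.symm.trans h')]

lemma BicliqueVertex.prev_unique {i j : Fin n} {p : Fin r} {u v : BicliqueVertex r n}
    (hu : u.Next (.inner i j p)) (hv : v.Next (.inner i j p)) : u = v := by
  rcases u with (_ | _ | ⟨i', j', p'⟩) <;> rcases v with (_ | _ | ⟨i'', j'', p''⟩) <;>
    simp only [BicliqueVertex.Next] at hu hv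
  · rw [hu.1, hv.1]
  · omega
  · omega
  · obtain ⟨rfl, rfl, h⟩ := hu
    obtain ⟨rfl, rfl, h'⟩ := hv
    rw [Fin.ext (Nat.succ_injective (h.trans h'.symm))]

lemma isNative_of_three_adj {u a b c : BicliqueVertex r n}
    (ha : (subdividedBiclique r n).Adj u a) (hb : (subdividedBiclique r n).Adj u b)
    (hc : (subdividedBiclique r n).Adj u c) (hab : a ≠ b) (hac : a ≠ c) (hbc : b ≠ c) :
    u.IsNative := by
  rw [subdividedBiclique_adj] at ha hb hc
  rcases u with (_ | _ | ⟨i, j, p⟩)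
  · trivial
  · trivial
  · rcases ha with ha | ha <;> rcases hb with hb | hb <;> rcases hc with hc | hc <;>
      first
      | exact absurd (BicliqueVertex.next_unique ha hb) hab
      | exact absurd (BicliqueVertex.next_unique ha hc) hac
      | exact absurd (BicliqueVertex.next_unique hb hc) hbc
      | exact absurd (BicliqueVertex.prev_unique ha hb) hab
      | exact absurd (BicliqueVertex.prev_unique ha hc) hac
      | exact absurd (BicliqueVertex.prev_unique hb hc) hbc

lemma next_of_adj_of_ne {i j : Fin n} {p : Fin r} {u v : BicliqueVertex r n}
    (hu : u.Next (.inner i j p)) (hv : (subdividedBiclique r n).Adj (.inner i j p) v)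
    (huv : u ≠ v) : (BicliqueVertex.inner i j p).Next v :=
  (subdividedBiclique_adj.1 hv).resolve_right fun h => huv (BicliqueVertex.prev_unique hu h)

variable [NeZero r]

lemma not_adj_of_isNative {u v : BicliqueVertex r n} (hu : u.IsNative) (hv : v.IsNative) :
    ¬ (subdividedBiclique r n).Adj u v := by
  have := NeZero.ne r
  rw [subdividedBiclique_adj]
  rcases u with (_ | _ | _) <;> rcases v with (_ | _ | _) <;>
    simp_all [BicliqueVertex.Next, BicliqueVertex.IsNative]

lemma exists_eq_inner_of_adj_left {x : Fin n} {u : BicliqueVertex r n}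
    (h : (subdividedBiclique r n).Adj (.left x) u) : ∃ y, u = .inner x y 0 := by
  have := NeZero.ne r
  rw [subdividedBiclique_adj] at h
  rcases u with (_ | _ | ⟨i, j, p⟩) <;> simp only [BicliqueVertex.Next, or_self, or_false] at h
  · contradiction
  · obtain ⟨rfl, hp⟩ := h
    exact ⟨j, by rw [Fin.ext (b := 0) (hp.trans (Fin.val_zero r).symm)]⟩

lemma eq_inner_of_path_from_left {x y : Fin n} {q : ℕ → BicliqueVertex r n} (h0 : q 0 = .left x)
    (h1 : q 1 = .inner x y 0)
    (hadj : ∀ t < r + 1, (subdividedBiclique r n).Adj (q t) (q (t + 1)))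
    (hne : ∀ t, t + 2 ≤ r + 1 → q t ≠ q (t + 2)) {t : ℕ} (ht : t < r) :
    q (t + 1) = .inner x y ⟨t, ht⟩ ∧ (q t).Next (.inner x y ⟨t, ht⟩) := by
  induction t with
  | zero => exact ⟨h1, by rw [h0]; exact ⟨rfl, rfl⟩⟩
  | succ t ih =>
    obtain ⟨hq, hprev⟩ := ih (by omega)
    have hnext : (BicliqueVertex.inner x y ⟨t, by omega⟩).Next (q (t + 2)) :=
      next_of_adj_of_ne hprev (hq ▸ hadj (t + 1) (by omega)) (hne t (by omega))
    rcases hq2 : q (t + 2) with (_ | _ | ⟨i, j, p⟩) <;> rw [hq2] at hnext <;>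
      simp only [BicliqueVertex.Next] at hnext
    · omega
    · obtain ⟨rfl, rfl, h⟩ := hnext
      obtain rfl : p = ⟨t + 1, ht⟩ := Fin.ext h.symm
      exact ⟨rfl, by rw [hq]; exact ⟨rfl, rfl, rfl⟩⟩

lemma exists_path_from_left_ends {x : Fin n} {q : ℕ → BicliqueVertex r n} (h0 : q 0 = .left x)
    (hadj : ∀ t < r + 1, (subdividedBiclique r n).Adj (q t) (q (t + 1)))
    (hne : ∀ t, t + 2 ≤ r + 1 → q t ≠ q (t + 2)) :
    ∃ y, q 1 = .inner x y 0 ∧ q (r + 1) = .right y := by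
  obtain ⟨y, h1⟩ := exists_eq_inner_of_adj_left (h0 ▸ hadj 0 (by omega))
  refine ⟨y, h1, ?_⟩
  obtain ⟨s, rfl⟩ := Nat.exists_eq_succ_of_ne_zero (NeZero.ne r)
  obtain ⟨hq, hprev⟩ := eq_inner_of_path_from_left h0 h1 hadj hne s.lt_succ_self
  have hnext := next_of_adj_of_ne hprev (hq ▸ hadj (s + 1) (by omega)) (hne s le_rfl)
  rcases hq2 : q (s + 2) with (_ | _ | ⟨i, j, p⟩) <;> rw [hq2] at hnext <;>
    simp only [BicliqueVertex.Next] at hnext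
  · rw [hnext.1]
  · omega

lemma exists_two_adj [Nontrivial (Fin n)] (w : BicliqueVertex r n) : ∃ w₁ w₂, w₁ ≠ w₂ ∧
    (subdividedBiclique r n).Adj w w₁ ∧ (subdividedBiclique r n).Adj w w₂ := by
  have hr := NeZero.ne r
  obtain ⟨x, y, hxy⟩ := exists_pair_ne (Fin n)
  simp only [subdividedBiclique_adj]
  rcases w with (a | b | ⟨a, b, p⟩)
  · exact ⟨.inner a x 0, .inner a y 0, by simpa using hxy, .inl ⟨rfl, rfl⟩, .inl ⟨rfl, rfl⟩⟩
  · have hlast : ((0 : Fin r).rev : ℕ) + 1 = r := by simp [Fin.val_rev]; omega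
    exact ⟨.inner x b _, .inner y b _, by simpa using hxy, .inr ⟨rfl, hlast⟩, .inr ⟨rfl, hlast⟩⟩
  · have exists_prev : ∃ w : BicliqueVertex r n, w.Next (.inner a b p) := by
      by_cases hp : (p : ℕ) = 0
      · exact ⟨.left a, rfl, hp⟩
      · exact ⟨.inner a b ⟨p - 1, by omega⟩, rfl, rfl, Nat.sub_add_cancel (by omega)⟩
    have exists_next : ∃ w, (BicliqueVertex.inner a b p).Next w := by
      by_cases hp : (p : ℕ) + 1 = r
      · exact ⟨.right b, rfl, hp⟩
      · exact ⟨.inner a b ⟨p + 1, by omega⟩, rfl, rfl, rfl⟩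
    obtain ⟨w₁, h₁⟩ := exists_prev
    obtain ⟨w₂, h₂⟩ := exists_next
    refine ⟨w₁, w₂, ?_, .inr h₁, .inl h₂⟩
    rintro rfl
    rcases w₁ with (_ | _ | _) <;> simp only [BicliqueVertex.Next] at h₁ h₂
    omega

end Biclique

/-! ### Induced embeddings into layer flips -/

section Rigidity

lemma exists_forall_mem_iff_mem {L : Type} [Finite L] {R : Set (Sym2 L)} {τ : L → L}
    (hτ : ∀ l l', s(τ l, τ l') ∈ R ↔ s(l, l') ∈ R) (m : L) :
    ∃ l, ∀ l', s(τ l, l') ∈ R ↔ s(m, l') ∈ R := by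
  -- `τ` induces an injective, hence surjective, map on the finitely many rows of `R`.
  let row (l : L) : Set L := {l' | s(l, l') ∈ R}
  have row_eq_of_row_map_eq {l l' : L} (h : row (τ l) = row (τ l')) : row l = row l' := by
    ext m
    exact (hτ l m).symm.trans ((Set.ext_iff.1 h (τ m)).trans (hτ l' m))
  choose rep hrep using fun x : Set.range row => x.2
  let mapRow (x : Set.range row) : Set.range row := ⟨row (τ (rep x)), Set.mem_range_self _⟩
  have mapRow_surjective : mapRow.Surjective := Finite.surjective_of_injective fun x y hxy =>
    Subtype.ext <| by
      rw [← hrep x, ← hrep y]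
      exact row_eq_of_row_map_eq (congrArg Subtype.val hxy)
  obtain ⟨x, hx⟩ := mapRow_surjective ⟨row m, Set.mem_range_self m⟩
  exact ⟨rep x, Set.ext_iff.1 (congrArg Subtype.val hx)⟩

lemma mem_iff_mem_of_forall_label {V L : Type} [Finite L] {R : Set (Sym2 L)} {τ : L → L}
    (hτ : ∀ l l', s(τ l, τ l') ∈ R ↔ s(l, l') ∈ R) {a b : V → L}
    (hab : ∀ v l, s(a v, l) ∈ R ↔ s(b v, τ l) ∈ R) (u v : V) :
    s(a u, a v) ∈ R ↔ s(b u, b v) ∈ R := by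
  obtain ⟨l, hl⟩ := exists_forall_mem_iff_mem hτ (b v)
  have row_eq (l' : L) : s(a v, l') ∈ R ↔ s(l, l') ∈ R :=
    (hab v l').trans ((hl (τ l')).symm.trans (hτ l l'))
  calc s(a u, a v) ∈ R ↔ s(a u, l) ∈ R := by rw [Sym2.eq_swap, row_eq, Sym2.eq_swap]
    _ ↔ s(b u, τ l) ∈ R := hab u l
    _ ↔ s(b u, b v) ∈ R := by rw [Sym2.eq_swap, hl, Sym2.eq_swap]

/-- The pads `{pad w s | w}`, for `s : S`, are disjoint unions of components of `G` of minimum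
degree at least two. They are labelled in the same way, and every label occurs in them. -/
structure IsPadding {V W S L : Type} (G : SimpleGraph V) (lab : V → L) (labW : W → L)
    (pad : W → S → V) : Prop where
  labW_surjective : labW.Surjective
  lab_pad : ∀ w s, lab (pad w s) = labW w
  index_eq : ∀ {w s w' s'}, pad w s = pad w' s' → s = s'
  not_adj : ∀ {v s}, (∀ w, v ≠ pad w s) → ∀ w, ¬ G.Adj v (pad w s)
  two_neighbors : ∀ w s, ∃ w₁ w₂, pad w₁ s ≠ pad w₂ s ∧
    G.Adj (pad w s) (pad w₁ s) ∧ G.Adj (pad w s) (pad w₂ s)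

namespace IsPadding

variable {V W S L : Type} {G : SimpleGraph V}

lemma comp {S' : Type} {lab : V → L} {labW : W → L} {pad : W → S → V}
    (hp : IsPadding G lab labW pad) (e : S' ↪ S) :
    IsPadding G lab labW fun w s => pad w (e s) where
  labW_surjective := hp.labW_surjective
  lab_pad w s := hp.lab_pad w (e s)
  index_eq h := e.injective (hp.index_eq h)
  not_adj h := hp.not_adj h
  two_neighbors w s := hp.two_neighbors w (e s)

variable {r M : ℕ} {R : Set (Sym2 (Fin (r + 2)))} {lab : V → Fin (r + 2)}
  {labW : W → Fin (r + 2)} {h : labelFlip G lab R ↪g layerFlip R M}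

section SameLayers

variable {pad : W → Fin 6 → V} {σ : W → Fin (r + 2)}

lemma map_pad_ne (hp : IsPadding G lab labW pad) {s s' : Fin 6} (hs : s ≠ s') (w w' : W) :
    h (pad w s) ≠ h (pad w' s') :=
  h.injective.ne fun he => hs (hp.index_eq he)

variable [NeZero r]

lemma mem_pad_iff (hp : IsPadding G lab labW pad) (hσ : ∀ s w, (h (pad w s)).layer = σ w)
    (w w' : W) : s(labW w, labW w') ∈ R ↔ s(σ w, σ w') ∈ R := by
  by_contra hmem
  have adj_of_ne {s s' : Fin 6} (hs : s ≠ s') :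
      (subdividedBiclique r M).Adj (h (pad w s)) (h (pad w' s')) := by
    have ne_pad (w' : W) : pad w s ≠ pad w' s' := fun he => hs (hp.index_eq he)
    refine adj_of_not_adj_of_not_mem_iff_mem h (ne_pad w') (hp.not_adj ne_pad w') ?_
    rwa [hp.lab_pad, hp.lab_pad, hσ, hσ]
  have isNative_left : (h (pad w 0)).IsNative :=
    isNative_of_three_adj (adj_of_ne (s' := 3) (by decide)) (adj_of_ne (s' := 4) (by decide))
      (adj_of_ne (s' := 5) (by decide)) (hp.map_pad_ne (by decide) _ _)
      (hp.map_pad_ne (by decide) _ _) (hp.map_pad_ne (by decide) _ _)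
  have isNative_right : (h (pad w' 3)).IsNative :=
    isNative_of_three_adj (adj_of_ne (s := 0) (by decide)).symm
      (adj_of_ne (s := 1) (by decide)).symm (adj_of_ne (s := 2) (by decide)).symm
      (hp.map_pad_ne (by decide) _ _) (hp.map_pad_ne (by decide) _ _)
      (hp.map_pad_ne (by decide) _ _)
  exact not_adj_of_isNative isNative_left isNative_right (adj_of_ne (by decide))

lemma adj_map_pad_of_adj (hp : IsPadding G lab labW pad)
    (hσ : ∀ s w, (h (pad w s)).layer = σ w) {s : Fin 6} {w w' : W}
    (hadj : G.Adj (pad w s) (pad w' s)) :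
    (subdividedBiclique r M).Adj (h (pad w s)) (h (pad w' s)) := by
  refine ((adj_iff_adj_iff_mem_iff_mem h hadj.ne).2 ?_).1 hadj
  rw [hp.lab_pad, hp.lab_pad, hσ, hσ, hp.mem_pad_iff hσ]

lemma mem_lab_labW_iff (hp : IsPadding G lab labW pad) (hσ : ∀ s w, (h (pad w s)).layer = σ w)
    (v : V) (w : W) : s(lab v, labW w) ∈ R ↔ s((h v).layer, σ w) ∈ R := by
  by_contra hmem
  obtain ⟨s₀, hs₀⟩ : ∃ s₀, ∀ s ≠ s₀, ∀ w, v ≠ pad w s := by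
    by_cases hv : ∃ s w, v = pad w s
    · obtain ⟨s, w, rfl⟩ := hv
      exact ⟨s, fun s' hs w' he => hs (hp.index_eq he).symm⟩
    · push Not at hv
      exact ⟨0, fun s _ => hv s⟩
  have adj_of_ne {s : Fin 6} (hs : s ≠ s₀) :
      (subdividedBiclique r M).Adj (h v) (h (pad w s)) := by
    refine adj_of_not_adj_of_not_mem_iff_mem h (hs₀ s hs w) (hp.not_adj (hs₀ s hs) w) ?_
    rwa [hp.lab_pad, hσ]
  have exists_three : ∀ s₀ : Fin 6, ∃ s₁ s₂ s₃, s₁ ≠ s₀ ∧ s₂ ≠ s₀ ∧ s₃ ≠ s₀ ∧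
      s₁ ≠ s₂ ∧ s₁ ≠ s₃ ∧ s₂ ≠ s₃ := by decide
  obtain ⟨s₁, s₂, s₃, h₁, h₂, h₃, h₁₂, h₁₃, h₂₃⟩ := exists_three s₀
  have isNative_v : (h v).IsNative :=
    isNative_of_three_adj (adj_of_ne h₁) (adj_of_ne h₂) (adj_of_ne h₃)
      (hp.map_pad_ne h₁₂ _ _) (hp.map_pad_ne h₁₃ _ _) (hp.map_pad_ne h₂₃ _ _)
  obtain ⟨w₁, w₂, hne, hw₁, hw₂⟩ := hp.two_neighbors w s₁
  have isNative_pad : (h (pad w s₁)).IsNative :=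
    isNative_of_three_adj (adj_of_ne h₁).symm (hp.adj_map_pad_of_adj hσ hw₁)
      (hp.adj_map_pad_of_adj hσ hw₂) (h.injective.ne (hs₀ _ h₁ _))
      (h.injective.ne (hs₀ _ h₁ _)) (h.injective.ne hne)
  exact not_adj_of_isNative isNative_v isNative_pad (adj_of_ne h₁)

lemma adj_map_iff_of_layer_eq (hp : IsPadding G lab labW pad)
    (hσ : ∀ s w, (h (pad w s)).layer = σ w) (u v : V) :
    (subdividedBiclique r M).Adj (h u) (h v) ↔ G.Adj u v := by
  rcases eq_or_ne u v with rfl | huv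
  · simp only [SimpleGraph.irrefl]
  obtain ⟨sec, labW_sec⟩ := hp.labW_surjective.hasRightInverse
  have mem_iff := mem_iff_mem_of_forall_label (R := R) (τ := σ ∘ sec) (a := lab)
    (b := fun v => (h v).layer)
    (fun l l' => by rw [Function.comp, Function.comp, ← hp.mem_pad_iff hσ, labW_sec, labW_sec])
    (fun v l => by rw [Function.comp, ← hp.mem_lab_labW_iff hσ, labW_sec])
  exact ((adj_iff_adj_iff_mem_iff_mem h huv).2 (mem_iff u v)).symm

end SameLayers

theorem adj_map_iff [NeZero r] [Finite W] [Finite S] {pad : W → S → V}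
    (hp : IsPadding G lab labW pad)
    (hS : Nat.card (W → Fin (r + 2)) * 6 ≤ Nat.card S)
    (h : labelFlip G lab R ↪g layerFlip R M) (u v : V) :
    (subdividedBiclique r M).Adj (h u) (h v) ↔ G.Adj u v := by
  obtain ⟨σ, e, he⟩ := exists_embedding_fiber (fun s w => (h (pad w s)).layer) hS
  exact (hp.comp e).adj_map_iff_of_layer_eq (fun s w => congrFun (he s) w) u v

end IsPadding

end Rigidity

/-! ### The gadget graph -/

section Gadget

/-- Indices of the disjoint pads of the gadget graph, enough of them for `IsPadding.adj_map_iff`. -/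
abbrev PadIndex (r : ℕ) : Type := (BicliqueVertex r 2 → Fin (r + 2)) × Fin 6

/-- The kinds of vertices of the gadget graph: hubs represent the vertices of the encoded graph,
leaves raise the degree of the hubs to three, two arms with a common middle vertex represent an
edge, and pads are the copies of the biclique of order `2` required by `IsPadding`. -/
inductive GadgetKind (r : ℕ) : Type
  | hub : GadgetKind r
  | leaf (s : Fin 3) : GadgetKind r
  | mid : GadgetKind r
  | arm (a : Fin 2) (p : Fin r) : GadgetKind r
  | pad (w : BicliqueVertex r 2) (s : PadIndex r) : GadgetKind r

/-- Labels for the native vertices of the biclique that hosts the gadget graph: `main` for hubs and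
middle vertices, and the other ones for the ends of leaves, of unused arms and of pads. -/
inductive GadgetPort (r : ℕ) : Type
  | main : GadgetPort r
  | leaf (s : Fin 3) : GadgetPort r
  | arm (a : Fin 2) : GadgetPort r
  | pad (s : PadIndex r) (a : Fin 2) : GadgetPort r

instance (r : ℕ) : Finite (GadgetKind r) := by
  let toSum : GadgetKind r →
      (Unit ⊕ Fin 3 ⊕ Unit) ⊕ (Fin 2 × Fin r) ⊕ (BicliqueVertex r 2 × PadIndex r)
    | .hub => .inl (.inl ())
    | .leaf s => .inl (.inr (.inl s))
    | .mid => .inl (.inr (.inr ()))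
    | .arm a p => .inr (.inl (a, p))
    | .pad w s => .inr (.inr (w, s))
  refine Finite.of_injective toSum ?_
  rintro (_ | _ | _ | _ | _) (_ | _ | _ | _ | _) h <;> simp_all [toSum]

instance (r : ℕ) : Finite (GadgetPort r) := by
  let toSum : GadgetPort r → (Unit ⊕ Fin 3) ⊕ Fin 2 ⊕ (PadIndex r × Fin 2)
    | .main => .inl (.inl ())
    | .leaf s => .inl (.inr s)
    | .arm a => .inr (.inl a)
    | .pad s a => .inr (.inr (s, a))
  refine Finite.of_injective toSum ?_
  rintro (_ | _ | _ | _) (_ | _ | _ | _) h <;> simp_all [toSum]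

/-- A cell of the table of a graph on `Fin n`: an entry of the adjacency matrix, or the end of a
row. -/
abbrev GridCell (n : ℕ) : Type := Fin n × Option (Fin n)

open Classical in
/-- The symbol at a cell of the table. -/
noncomputable def cellSymbol {n : ℕ} (H : SimpleGraph (Fin n)) (c : GridCell n) : Option Bool :=
  c.2.map fun j => decide (H.Adj c.1 j)

lemma cellSymbol_eq_none_iff {n : ℕ} {H : SimpleGraph (Fin n)} {c : GridCell n} :
    cellSymbol H c = none ↔ c.2 = none :=
  Option.map_eq_none_iff

/-- What the adjacency of gadget vertices in two cells depends on, besides their kinds. -/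
structure CellFlags : Type where
  symbol : Option Bool
  symbol' : Option Bool
  sameRow : Bool
  sameCol : Bool
  /-- The column of the first cell has the index of the row of the second one. -/
  colRow : Bool
  /-- The row of the first cell has the index of the column of the second one. -/
  rowCol : Bool

/-- The flags for the opposite order of cells. -/
def CellFlags.swap (x : CellFlags) : CellFlags :=
  ⟨x.symbol', x.symbol, x.sameRow, x.sameCol, x.rowCol, x.colRow⟩

/-- The flags of two cells. -/
noncomputable def cellFlags {n : ℕ} (H : SimpleGraph (Fin n)) (c d : GridCell n) : CellFlags where
  symbol := cellSymbol H c
  symbol' := cellSymbol H d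
  sameRow := decide (c.1 = d.1)
  sameCol := decide (c.2 = d.2)
  colRow := decide (c.2 = some d.1)
  rowCol := decide (d.2 = some c.1)

lemma cellFlags_swap {n : ℕ} (H : SimpleGraph (Fin n)) (c d : GridCell n) :
    (cellFlags H c d).swap = cellFlags H d c := by
  simp [cellFlags, CellFlags.swap, eq_comm]

variable {r n m : ℕ}

/-- The map of the cells of tables induced by a map of their indices. -/
def GridCell.map (e : Fin m → Fin n) (c : GridCell m) : GridCell n := (e c.1, c.2.map e)

lemma GridCell.map_injective {e : Fin m → Fin n} (he : e.Injective) :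
    (GridCell.map e).Injective :=
  he.prodMap (Option.map_injective he)

lemma cellFlags_map {K : SimpleGraph (Fin m)} {H : SimpleGraph (Fin n)} (e : K ↪g H)
    (c d : GridCell m) : cellFlags H (c.map e) (d.map e) = cellFlags K c d := by
  have cellSymbol_map (c : GridCell m) : cellSymbol H (c.map e) = cellSymbol K c := by
    rcases c with ⟨i, _ | j⟩
    · rfl
    · exact congrArg some (decide_eq_decide.2 e.map_adj_iff)
  have map_eq_map_iff (o o' : Option (Fin m)) : o.map e = o'.map e ↔ o = o' :=
    (Option.map_injective e.injective).eq_iff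
  have map_eq_some_iff (o : Option (Fin m)) (i : Fin m) : o.map e = some (e i) ↔ o = some i :=
    map_eq_map_iff o (some i)
  simp only [cellFlags, cellSymbol_map]
  simp only [GridCell.map, map_eq_map_iff, map_eq_some_iff, e.injective.eq_iff]

/-- The number of native vertices on either side of the biclique that hosts the gadget graph. -/
noncomputable def hostSize (r n : ℕ) : ℕ := Nat.card (GridCell n × GadgetPort r)

/-- The native vertex with a given label. -/
noncomputable def host (x : GridCell n × GadgetPort r) : Fin (hostSize r n) := Finite.equivFin _ x

lemma host_inj {x y : GridCell n × GadgetPort r} : host x = host y ↔ x = y :=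
  (Finite.equivFin _).injective.eq_iff

open Classical in
/-- The left vertex where an arm begins: one of the hubs if the arm belongs to an edge. -/
noncomputable def armAnchor (H : SimpleGraph (Fin n)) (c : GridCell n) (a : Fin 2) :
    GridCell n × GadgetPort r :=
  match c.2 with
  | some j => if H.Adj c.1 j then ((if a = 0 then c.1 else j, none), .main) else (c, .arm a)
  | none => (c, .arm a)

lemma armAnchor_inj {H : SimpleGraph (Fin n)} {c : GridCell n} {a b : Fin 2} :
    armAnchor (r := r) H c a = armAnchor H c b ↔ a = b := by
  refine ⟨fun h => ?_, fun h => h ▸ rfl⟩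
  unfold armAnchor at h
  rcases c with ⟨i, _ | j⟩
  · exact GadgetPort.arm.inj (Prod.ext_iff.1 h).2
  · by_cases hij : H.Adj i j
    · have := hij.ne
      fin_cases a <;> fin_cases b <;> simp_all [eq_comm]
    · simpa [hij] using h

lemma main_eq_armAnchor_iff {H : SimpleGraph (Fin n)} {c d : GridCell n} {a : Fin 2} :
    (c, GadgetPort.main (r := r)) = armAnchor H d a ↔ c.2 = none ∧ cellSymbol H d = some true ∧
      if a = 0 then c.1 = d.1 else d.2 = some c.1 := by
  obtain ⟨i, o⟩ := c
  rcases d with ⟨i', _ | j'⟩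
  · simp [armAnchor, cellSymbol]
  · by_cases hadj : H.Adj i' j' <;> by_cases ha : a = 0 <;>
      simp [armAnchor, cellSymbol, hadj, ha, and_comm, eq_comm]

lemma adj_of_armAnchor_eq {H : SimpleGraph (Fin n)} {c : GridCell n} {a b : Fin 2} {i j : Fin n}
    (hij : i ≠ j) (ha : armAnchor (r := r) H c a = ((i, none), .main))
    (hb : armAnchor (r := r) H c b = ((j, none), .main)) : H.Adj i j := by
  rcases c with ⟨i', _ | j'⟩
  · simp [armAnchor] at ha
  · by_cases hadj : H.Adj i' j'
    · have := hadj.symm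
      grind [armAnchor]
    · simp [armAnchor, hadj] at ha

lemma armAnchor_eq_main_or_arm (H : SimpleGraph (Fin n)) (c : GridCell n) (a : Fin 2) :
    (armAnchor (r := r) H c a).2 = .main ∨ (armAnchor (r := r) H c a).2 = .arm a := by
  unfold armAnchor
  rcases c with ⟨i, _ | j⟩
  · exact .inr rfl
  · by_cases hadj : H.Adj i j
    · exact .inl (by simp only [hadj, if_true])
    · exact .inr (by simp only [hadj, if_false])

lemma leaf_ne_armAnchor {H : SimpleGraph (Fin n)} {c d : GridCell n} {s : Fin 3} {a : Fin 2} :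
    (c, GadgetPort.leaf (r := r) s) ≠ armAnchor H d a := fun h => by
  simpa [← h] using armAnchor_eq_main_or_arm (r := r) H d a

lemma pad_ne_armAnchor {H : SimpleGraph (Fin n)} {c d : GridCell n} {s : PadIndex r}
    {a b : Fin 2} : (c, GadgetPort.pad s b) ≠ armAnchor H d a := fun h => by
  simpa [← h] using armAnchor_eq_main_or_arm (r := r) H d a

/-- The vertex of the gadget graph that represents `i`. -/
def gadgetHub (i : Fin n) : GridCell n × GadgetKind r := ((i, none), .hub)

lemma gadgetHub_injective : Function.Injective (gadgetHub (r := r) (n := n)) := fun i j h => by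
  simpa [gadgetHub] using h

/-- The vertices along an arm of an edge, from the hub to the middle vertex. -/
def armPath (k k' : Fin n) (a : Fin 2) : ℕ → GridCell n × GadgetKind r
  | 0 => gadgetHub (if a = 0 then k else k')
  | t + 1 => ((k, some k'), if ht : t < r then .arm a ⟨t, ht⟩ else .mid)

lemma armPath_ne {k k' : Fin n} {a : Fin 2} {t : ℕ} (ht : t + 2 ≤ r + 1) :
    armPath (r := r) k k' a t ≠ armPath k k' a (t + 2) := by
  rcases t with _ | t
  · simp [armPath, gadgetHub]
  · have ht : t < r := by omega
    by_cases ht' : t + 2 < r <;> simp [armPath, ht, ht']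

section

variable [NeZero r]

/-- The layer of the gadget vertices of a given kind in the hosting biclique. -/
def GadgetKind.layer : GadgetKind r → Fin (r + 2)
  | .hub => 0
  | .leaf _ => (0 : Fin r).succ.castSucc
  | .mid => Fin.last _
  | .arm _ p => p.succ.castSucc
  | .pad w _ => w.layer

/-- The place of the gadget vertices in the hosting biclique. Away from the ends of rows, where the
hubs of the encoded graph are, leaves do not share their left end. -/
noncomputable def gadgetPlace (H : SimpleGraph (Fin n)) :
    GridCell n × GadgetKind r → BicliqueVertex r (hostSize r n)
  | (c, .hub) => .left (host (c, .main))
  | (c, .leaf s) => .inner (host (c, if c.2 = none then .main else .leaf s)) (host (c, .leaf s)) 0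
  | (c, .mid) => .right (host (c, .main))
  | (c, .arm a p) => .inner (host (armAnchor H c a)) (host (c, .main)) p
  | (c, .pad w s) => w.map (fun a => host (c, .pad s a)) (fun b => host (c, .pad s b))

lemma layer_gadgetPlace (H : SimpleGraph (Fin n)) (u : GridCell n × GadgetKind r) :
    (gadgetPlace H u).layer = u.2.layer := by
  rcases u with ⟨c, _ | _ | _ | _ | w⟩
  case pad => exact BicliqueVertex.layer_map ..
  all_goals rfl

lemma gadgetPlace_injective (H : SimpleGraph (Fin n)) :
    Function.Injective (gadgetPlace (r := r) H) := by
  rintro ⟨c, _ | _ | _ | _ | ⟨_ | _ | _, _⟩⟩ ⟨d, _ | _ | _ | _ | ⟨_ | _ | _, _⟩⟩ h <;>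
    grind [gadgetPlace, BicliqueVertex.map, host_inj, armAnchor_inj]

/-- Whether a gadget vertex precedes another one on a path of the hosting biclique, in terms of
kinds and flags. -/
def GadgetKind.Next : GadgetKind r → GadgetKind r → CellFlags → Prop
  | .hub, .leaf _, x => x.sameRow ∧ x.sameCol ∧ x.symbol = none
  | .hub, .arm a p, x => x.symbol = none ∧ x.symbol' = some true ∧
      (if a = 0 then x.sameRow else x.rowCol) ∧ (p : ℕ) = 0
  | .arm a p, .arm b q, x => x.sameRow ∧ x.sameCol ∧ a = b ∧ (p : ℕ) + 1 = q
  | .arm _ p, .mid, x => x.sameRow ∧ x.sameCol ∧ (p : ℕ) + 1 = r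
  | .pad w s, .pad w' s', x => x.sameRow ∧ x.sameCol ∧ s = s' ∧ w.Next w'
  | _, _, _ => False

lemma next_gadgetPlace (H : SimpleGraph (Fin n)) (u v : GridCell n × GadgetKind r) :
    (gadgetPlace H u).Next (gadgetPlace H v) ↔ u.2.Next v.2 (cellFlags H u.1 v.1) := by
  have hr := NeZero.ne r
  have hzero := Fin.val_zero r
  rcases u with ⟨c, _ | _ | _ | _ | ⟨_ | _ | _, _⟩⟩ <;>
    rcases v with ⟨d, _ | _ | _ | _ | ⟨_ | _ | _, _⟩⟩ <;>
    grind [gadgetPlace, BicliqueVertex.map, BicliqueVertex.Next, GadgetKind.Next, cellFlags,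
      host_inj, armAnchor_inj, main_eq_armAnchor_iff, leaf_ne_armAnchor, pad_ne_armAnchor,
      cellSymbol_eq_none_iff]

/-- The gadget graph before the flip. -/
noncomputable def gadgetSkeleton (H : SimpleGraph (Fin n)) :
    SimpleGraph (GridCell n × GadgetKind r) :=
  (subdividedBiclique r (hostSize r n)).comap (gadgetPlace H)

lemma gadgetSkeleton_adj {H : SimpleGraph (Fin n)} {u v : GridCell n × GadgetKind r} :
    (gadgetSkeleton H).Adj u v ↔
      u.2.Next v.2 (cellFlags H u.1 v.1) ∨ v.2.Next u.2 (cellFlags H v.1 u.1) := by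
  rw [gadgetSkeleton, SimpleGraph.comap_adj, subdividedBiclique_adj, next_gadgetPlace,
    next_gadgetPlace]

/-- The map of gadget skeletons induced by an embedding of graphs. -/
def gadgetSkeletonMap {K : SimpleGraph (Fin m)} {H : SimpleGraph (Fin n)} (e : K ↪g H) :
    gadgetSkeleton (r := r) K ↪g gadgetSkeleton (r := r) H where
  toFun u := (u.1.map e, u.2)
  inj' := (GridCell.map_injective e.injective).prodMap fun _ _ => id
  map_rel_iff' {u v} := by
    change (gadgetSkeleton H).Adj (u.1.map e, u.2) (v.1.map e, v.2) ↔ _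
    simp only [gadgetSkeleton_adj, cellFlags_map]

variable {R : Set (Sym2 (Fin (r + 2)))}

/-- The graph that encodes `H` in the flips of bicliques along the relation `R` between layers. -/
noncomputable def gadgetGraph (R : Set (Sym2 (Fin (r + 2)))) (H : SimpleGraph (Fin n)) :
    SimpleGraph (GridCell n × GadgetKind r) :=
  labelFlip (gadgetSkeleton H) (fun u => u.2.layer) R

/-- The gadget graph is an induced subgraph of the flipped biclique. -/
noncomputable def gadgetGraphEmbedding (R : Set (Sym2 (Fin (r + 2)))) (H : SimpleGraph (Fin n)) :
    gadgetGraph R H ↪g layerFlip R (hostSize r n) :=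
  labelFlipEmbedding (SimpleGraph.Embedding.comap ⟨_, gadgetPlace_injective H⟩ _) fun u v =>
    iff_of_eq <| congrArg (· ∈ R) <| congrArg₂ _ (layer_gadgetPlace H u) (layer_gadgetPlace H v)

/-- The map of gadget graphs induced by an embedding of graphs. -/
noncomputable def gadgetGraphMap {K : SimpleGraph (Fin m)} {H : SimpleGraph (Fin n)}
    (R : Set (Sym2 (Fin (r + 2)))) (e : K ↪g H) : gadgetGraph R K ↪g gadgetGraph R H :=
  labelFlipEmbedding (gadgetSkeletonMap e) fun _ _ => Iff.rfl

/-- Adjacency in the gadget graph, in terms of kinds and flags. -/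
def GadgetKind.Linked (R : Set (Sym2 (Fin (r + 2)))) (t t' : GadgetKind r) (x : CellFlags) : Prop :=
  ¬ (x.sameRow ∧ x.sameCol ∧ t = t') ∧
    Xor (t.Next t' x ∨ t'.Next t x.swap) (s(t.layer, t'.layer) ∈ R)

lemma gadgetGraph_adj {H : SimpleGraph (Fin n)} {u v : GridCell n × GadgetKind r} :
    (gadgetGraph R H).Adj u v ↔ u.2.Linked R v.2 (cellFlags H u.1 v.1) := by
  change u ≠ v ∧ Xor ((gadgetSkeleton H).Adj u v) _ ↔ _
  rw [gadgetSkeleton_adj, GadgetKind.Linked, cellFlags_swap]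
  refine and_congr_left fun _ => not_congr ?_
  simp [Prod.ext_iff, cellFlags, and_assoc]

variable {K : SimpleGraph (Fin m)} {H : SimpleGraph (Fin n)}

lemma isPadding_gadgetSkeleton (c : GridCell n) :
    IsPadding (gadgetSkeleton (r := r) H) (fun u => u.2.layer) (BicliqueVertex.layer (n := 2))
      fun w s => (c, .pad w s) where
  labW_surjective := BicliqueVertex.layer_surjective
  lab_pad _ _ := rfl
  index_eq h := (GadgetKind.pad.inj (Prod.ext_iff.1 h).2).2
  not_adj := by
    rintro ⟨d, t⟩ s hne w hadj
    rw [gadgetSkeleton_adj] at hadj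
    rcases t with _ | _ | _ | _ | ⟨w', s'⟩ <;>
      simp only [GadgetKind.Next, cellFlags, decide_eq_true_eq, or_self] at hadj
    rcases hadj with ⟨row_eq, col_eq, rfl, -⟩ | ⟨row_eq, col_eq, rfl, -⟩
    · exact hne w' (by rw [Prod.ext row_eq col_eq])
    · exact hne w' (by rw [Prod.ext row_eq col_eq])
  two_neighbors w s := by
    obtain ⟨w₁, w₂, hne, h₁, h₂⟩ := exists_two_adj w
    rw [subdividedBiclique_adj] at h₁ h₂
    refine ⟨w₁, w₂, by simpa using hne, ?_⟩
    simpa [gadgetSkeleton_adj, GadgetKind.Next, cellFlags] using ⟨h₁, h₂⟩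

lemma gadgetSkeleton_adj_map_iff (h : gadgetGraph R K ↪g gadgetGraph R H)
    (u v : GridCell m × GadgetKind r) :
    (gadgetSkeleton H).Adj (h u) (h v) ↔ (gadgetSkeleton K).Adj u v :=
  (isPadding_gadgetSkeleton u.1).adj_map_iff (by simp [Nat.card_prod])
    ((gadgetGraphEmbedding R H).comp h) u v

lemma eq_arm_of_adj_mid {c : GridCell n} {u : GridCell n × GadgetKind r}
    (h : (gadgetSkeleton H).Adj (c, .mid) u) : ∃ a, u = (c, .arm a (Fin.rev 0)) := by
  have hzero := Fin.val_zero r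
  rw [gadgetSkeleton_adj] at h
  rcases u with ⟨d, _ | _ | _ | ⟨a, p⟩ | _⟩ <;>
    grind [GadgetKind.Next, cellFlags, Fin.ext_iff]

lemma eq_pad_of_adj_pad_left {c : GridCell n} {x : Fin 2} {s : PadIndex r}
    {u : GridCell n × GadgetKind r} (h : (gadgetSkeleton H).Adj (c, .pad (.left x) s) u) :
    ∃ y, u = (c, .pad (.inner x y 0) s) := by
  have hr := NeZero.ne r
  have hzero := Fin.val_zero r
  rw [gadgetSkeleton_adj] at h
  rcases u with ⟨d, _ | _ | _ | _ | ⟨_ | _ | ⟨_, _, _⟩, _⟩⟩ <;>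
    grind [GadgetKind.Next, BicliqueVertex.Next, cellFlags, Fin.ext_iff]

lemma eq_pad_of_adj_pad_right {c : GridCell n} {y : Fin 2} {s : PadIndex r}
    {u : GridCell n × GadgetKind r} (h : (gadgetSkeleton H).Adj (c, .pad (.right y) s) u) :
    ∃ x, u = (c, .pad (.inner x y (Fin.rev 0)) s) := by
  have hr := NeZero.ne r
  have hzero := Fin.val_zero r
  rw [gadgetSkeleton_adj] at h
  rcases u with ⟨d, _ | _ | _ | _ | ⟨_ | _ | ⟨_, _, _⟩, _⟩⟩ <;>
    grind [GadgetKind.Next, BicliqueVertex.Next, cellFlags, Fin.ext_iff]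

lemma eq_gadgetHub_of_adj {c : GridCell n} {u : GridCell n × GadgetKind r}
    (h : (gadgetSkeleton H).Adj (c, .hub) u) : (c, GadgetKind.hub (r := r)) = gadgetHub c.1 := by
  rw [gadgetSkeleton_adj] at h
  rcases u with ⟨d, _ | _ | _ | _ | _⟩ <;>
    grind [GadgetKind.Next, cellFlags, cellSymbol_eq_none_iff, gadgetHub]

lemma exists_eq_gadgetHub_of_three_adj {v a b c : GridCell n × GadgetKind r}
    (ha : (gadgetSkeleton H).Adj v a) (hb : (gadgetSkeleton H).Adj v b)
    (hc : (gadgetSkeleton H).Adj v c) (hab : a ≠ b) (hac : a ≠ c) (hbc : b ≠ c) :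
    ∃ i, v = gadgetHub i := by
  have isNative_v : (gadgetPlace H v).IsNative := isNative_of_three_adj ha hb hc
    ((gadgetPlace_injective H).ne hab) ((gadgetPlace_injective H).ne hac)
    ((gadgetPlace_injective H).ne hbc)
  have not_two (f : Fin 2 → GridCell n × GadgetKind r)
      (hf : ∀ u, (gadgetSkeleton H).Adj v u → ∃ x, u = f x) : False := by
    obtain ⟨⟨x, rfl⟩, ⟨y, rfl⟩, ⟨z, rfl⟩⟩ := And.intro (hf a ha) (And.intro (hf b hb) (hf c hc))
    have := ne_of_apply_ne f hab
    have := ne_of_apply_ne f hac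
    have := ne_of_apply_ne f hbc
    omega
  rcases v with ⟨d, _ | _ | _ | _ | ⟨x | y | _, s⟩⟩
  case hub => exact ⟨d.1, eq_gadgetHub_of_adj ha⟩
  case mid => exact (not_two _ fun u => eq_arm_of_adj_mid).elim
  case pad.left => exact (not_two _ fun u => eq_pad_of_adj_pad_left).elim
  case pad.right => exact (not_two _ fun u => eq_pad_of_adj_pad_right).elim
  all_goals exact isNative_v.elim

lemma exists_map_gadgetHub (h : gadgetGraph R K ↪g gadgetGraph R H) (k : Fin m) :
    ∃ i, h (gadgetHub k) = gadgetHub i := by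
  have adj_leaf (s : Fin 3) :
      (gadgetSkeleton H).Adj (h (gadgetHub k)) (h ((k, none), .leaf s)) := by
    rw [gadgetSkeleton_adj_map_iff, gadgetSkeleton_adj]
    simp [gadgetHub, GadgetKind.Next, cellFlags, cellSymbol]
  have leaf_ne {s s' : Fin 3} (hs : s ≠ s') :
      h ((k, none), .leaf s) ≠ h ((k, none), .leaf s') := by
    simpa using hs
  exact exists_eq_gadgetHub_of_three_adj (adj_leaf 0) (adj_leaf 1) (adj_leaf 2)
    (leaf_ne (by decide)) (leaf_ne (by decide)) (leaf_ne (by decide))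

lemma adj_armPath_succ {k k' : Fin n} (hadj : H.Adj k k') {a : Fin 2} {t : ℕ} (ht : t < r + 1) :
    (gadgetSkeleton (r := r) H).Adj (armPath k k' a t) (armPath k k' a (t + 1)) := by
  rw [gadgetSkeleton_adj]
  left
  rcases t with _ | t
  · have := NeZero.pos r
    by_cases ha : a = 0 <;>
      simp [armPath, this, ha, gadgetHub, GadgetKind.Next, cellFlags, cellSymbol, hadj]
  · have ht : t < r := by omega
    by_cases ht' : t + 1 < r
    · simp [armPath, ht, ht', GadgetKind.Next, cellFlags]
    · simpa [armPath, ht, ht', GadgetKind.Next, cellFlags] using by omega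

lemma exists_arm_of_gadgetPlace_eq {u v : GridCell n × GadgetKind r}
    {x : GridCell n} {y : Fin (hostSize r n)}
    (hu : gadgetPlace H u = .inner (host (x, .main)) y 0) (hv : gadgetPlace H v = .right y) :
    ∃ c b, armAnchor (r := r) H c b = (x, .main) ∧ v = (c, .mid) := by
  rcases u with ⟨c, _ | _ | _ | ⟨a, _⟩ | ⟨_ | _ | _, _⟩⟩ <;>
    rcases v with ⟨d, _ | _ | _ | _ | ⟨_ | _ | _, _⟩⟩ <;>
    grind [gadgetPlace, BicliqueVertex.map, host_inj]

lemma exists_arm_of_adj (h : gadgetGraph R K ↪g gadgetGraph R H) {k k' : Fin m} (hadj : K.Adj k k')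
    {a : Fin 2} {i : Fin n} (hi : h (gadgetHub (if a = 0 then k else k')) = gadgetHub i) :
    ∃ c b, armAnchor (r := r) H c b = ((i, none), .main) ∧ h ((k, some k'), .mid) = (c, .mid) := by
  obtain ⟨y, hy₁, hy₂⟩ := exists_path_from_left_ends
    (q := fun t => gadgetPlace H (h (armPath k k' a t))) (x := host ((i, none), .main))
    (congrArg (gadgetPlace H) hi)
    (fun t ht => (gadgetSkeleton_adj_map_iff h _ _).2 (adj_armPath_succ hadj ht))
    (fun t ht => (gadgetPlace_injective H).ne (h.injective.ne (armPath_ne ht)))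
  have armPath_end : armPath (r := r) k k' a (r + 1) = ((k, some k'), .mid) := by simp [armPath]
  exact armPath_end ▸ exists_arm_of_gadgetPlace_eq hy₁ hy₂

lemma adj_of_map_gadgetHub (h : gadgetGraph R K ↪g gadgetGraph R H) {k k' : Fin m}
    (hadj : K.Adj k k') {i j : Fin n} (hi : h (gadgetHub k) = gadgetHub i)
    (hj : h (gadgetHub k') = gadgetHub j) : H.Adj i j := by
  have hij : i ≠ j := by
    rintro rfl
    exact hadj.ne (gadgetHub_injective (h.injective (hi.trans hj.symm)))
  obtain ⟨c, a, hc, hmid⟩ := exists_arm_of_adj h hadj (a := 0) hi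
  obtain ⟨d, b, hd, hmid'⟩ := exists_arm_of_adj h hadj (a := 1) hj
  obtain rfl : c = d := congrArg Prod.fst (hmid.symm.trans hmid')
  exact adj_of_armAnchor_eq hij hc hd

end
end Gadget

/-! ### Sweeping machines -/

section SweepMap

variable {Q A B P : Type} (f : Q → A → Q) (g : Q → A → B)

/-- The outputs of a transducer with transition function `f` and output function `g` that reads a
list from left to right; the state it reaches is given by `List.foldl f`. -/
def sweepMap : Q → List A → List B
  | _, [] => []
  | q, x :: l => g q x :: sweepMap (f q x) l

@[simp] lemma length_sweepMap (q : Q) (l : List A) : (sweepMap f g q l).length = l.length := by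
  induction l generalizing q with
  | nil => rfl
  | cons x l ih => exact congrArg Nat.succ (ih _)

variable {f g}

lemma foldl_map_iterate {next : P → P} {c : P → A} {st : P → Q} {p : P} {k : ℕ}
    (h : ∀ x ∈ List.iterate next p k, f (st x) (c x) = st (next x)) :
    ((List.iterate next p k).map c).foldl f (st p) = st (next^[k] p) := by
  induction k generalizing p with
  | zero => rfl
  | succ k ih =>
    simp only [List.iterate, List.mem_cons, forall_eq_or_imp] at h
    rw [List.iterate, List.map_cons, List.foldl_cons, h.1, ih h.2, Function.iterate_succ_apply]

lemma sweepMap_map_iterate {next : P → P} {c : P → A} {st : P → Q} {p : P} {k : ℕ}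
    (h : ∀ x ∈ List.iterate next p k, f (st x) (c x) = st (next x)) :
    sweepMap f g (st p) ((List.iterate next p k).map c) =
      (List.iterate next p k).map fun x => g (st x) (c x) := by
  induction k generalizing p with
  | zero => rfl
  | succ k ih =>
    simp only [List.iterate, List.mem_cons, forall_eq_or_imp] at h
    rw [List.iterate, List.map_cons, List.map_cons, sweepMap, h.1, ih h.2]

end SweepMap

/-- A machine that reads its input into a list of cells and then repeatedly sweeps over this list,
rewriting each of the cells and printing a block of `width` bits for each of them. As it prints onto
a stack, what is printed later comes first in the output. -/
structure SweepMachine where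
  State : Type
  /-- The possible contents of a cell. -/
  Cell : Type
  [finite_state : Finite State]
  [finite_cell : Finite Cell]
  [inhabited_cell : Inhabited Cell]
  /-- The number of bits printed at a cell. -/
  width : ℕ
  init : State
  /-- The state after reading an input symbol. -/
  readState : State → Option Bool → State
  /-- The cell that represents an input symbol. -/
  readCell : State → Option Bool → Cell
  /-- Whether there is another sweep to do. -/
  alive : State → Bool
  /-- The state after a sweep passes a cell. -/
  next : State → Cell → State
  /-- The new contents of a cell. -/
  write : State → Cell → Cell
  /-- The bits printed at a cell. -/
  bits : State → Cell → Fin width → Bool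
  /-- The update of the state at the end of a pass. -/
  turn : State → State

attribute [instance] SweepMachine.finite_state SweepMachine.finite_cell SweepMachine.inhabited_cell

namespace SweepMachine

section Sweeps

variable (S : SweepMachine)

/-- The configuration between two sweeps: the state, the cells and the output. -/
abbrev Conf : Type := S.State × List S.Cell × List (Option Bool)

/-- The block printed at a cell. -/
def block (q : S.State) (c : S.Cell) : List (Option Bool) :=
  (List.finRange S.width).map fun t => some (S.bits q c t)

/-- The configuration after reading the input. -/
def start (w : List (Option Bool)) : S.Conf :=
  (S.turn (w.foldl S.readState S.init), sweepMap S.readState S.readCell S.init w, [])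

/-- The effect of one sweep, which also terminates its output by `none`. -/
def sweep (x : S.Conf) : S.Conf :=
  (S.turn (x.2.1.foldl S.next x.1), sweepMap S.next S.write x.1 x.2.1,
    (sweepMap S.next S.block x.1 x.2.1).reverse.flatten ++ none :: x.2.2)

/-- Whether the machine does at least `k` sweeps from `x`, and the first `k` of them lead
to `y`. -/
def SweepsTo : ℕ → S.Conf → S.Conf → Prop
  | 0, x, y => x = y
  | k + 1, x, y => S.alive x.1 = true ∧ SweepsTo k (S.sweep x) y

variable {S}

lemma start_map_iterate {P : Type} {next : P → P} {st : P → S.State} {c : P → Option Bool} {p : P}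
    {k : ℕ} (hinit : S.init = st p)
    (h : ∀ x ∈ List.iterate next p k, S.readState (st x) (c x) = st (next x)) :
    S.start ((List.iterate next p k).map c) = (S.turn (st (next^[k] p)),
      (List.iterate next p k).map fun x => S.readCell (st x) (c x), []) := by
  rw [start, hinit, foldl_map_iterate h, sweepMap_map_iterate h]

lemma sweep_map_iterate {P : Type} {next : P → P} {st : P → S.State} {c : P → S.Cell} {p : P}
    {k : ℕ} (h : ∀ x ∈ List.iterate next p k, S.next (st x) (c x) = st (next x))
    (o : List (Option Bool)) :
    S.sweep (st p, (List.iterate next p k).map c, o) = (S.turn (st (next^[k] p)),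
      (List.iterate next p k).map fun x => S.write (st x) (c x),
      ((List.iterate next p k).map fun x => S.block (st x) (c x)).reverse.flatten ++
        none :: o) := by
  simp only [sweep, foldl_map_iterate h, sweepMap_map_iterate h]

lemma SweepsTo.single {x y : S.Conf} (hx : S.alive x.1 = true) (h : S.sweep x = y) :
    S.SweepsTo 1 x y := ⟨hx, h⟩

lemma SweepsTo.trans {k l : ℕ} {x y z : S.Conf} (h : S.SweepsTo k x y) (h' : S.SweepsTo l y z) :
    S.SweepsTo (k + l) x z := by
  induction k generalizing x with
  | zero =>
    obtain rfl : x = y := h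
    rwa [Nat.zero_add]
  | succ k ih =>
    rw [Nat.add_right_comm]
    exact ⟨h.1, ih h.2⟩

lemma SweepsTo.iterate {P : Type} {next : P → P} {conf : P → List (Option Bool) → S.Conf}
    {rows : P → List (Option Bool)} {c k : ℕ} {p : P}
    (h : ∀ x ∈ List.iterate next p k, ∀ o,
      S.SweepsTo c (conf x o) (conf (next x) (rows x ++ o))) (o : List (Option Bool)) :
    S.SweepsTo (c * k) (conf p o)
      (conf (next^[k] p) (((List.iterate next p k).map rows).reverse.flatten ++ o)) := by
  induction k generalizing p o with
  | zero => exact rfl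
  | succ k ih =>
    simp only [List.iterate, List.mem_cons, forall_eq_or_imp] at h
    rw [Nat.mul_succ, Nat.add_comm]
    simpa [List.iterate] using (h.1 o).trans (ih h.2 (rows p ++ o))

end Sweeps

section Program

/-- The tapes of the Turing machine; the cells of the sweeping machine are on `left` and `right`,
on either side of its head. -/
inductive Stack : Type
  | inp | left | right | out
  deriving DecidableEq

/-- The labels of the Turing machine: reading the input, returning to the first cell, sweeping, and
clearing the cells after the last sweep. -/
inductive Label : Type
  | read | back | forth | clean
  deriving DecidableEq

instance : Fintype Stack where
  elems := {.inp, .left, .right, .out}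
  complete := by rintro (_ | _ | _ | _) <;> decide

instance : Fintype Label where
  elems := {.read, .back, .forth, .clean}
  complete := by rintro (_ | _ | _ | _) <;> decide

variable (S : SweepMachine)

/-- The alphabets of the tapes. -/
def Alphabet : Stack → Type
  | .inp => Option Bool
  | .left => S.Cell
  | .right => S.Cell
  | .out => Option Bool

/-- The registers of the Turing machine: the state and the last symbols popped. -/
abbrev Reg : Type := S.State × Option (Option Bool) × Option S.Cell

/-- The statements of the Turing machine. -/
abbrev Stmt : Type := Turing.TM2.Stmt S.Alphabet Label S.Reg

/-- The configurations of the Turing machine. -/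
abbrev Cfg : Type := Turing.TM2.Cfg S.Alphabet Label S.Reg

/-- Pushing the given bits of the block of the current cell, before the statement `q`. The first bit
is pushed last. -/
def printBlock : List (Fin S.width) → S.Stmt → S.Stmt
  | [], q => q
  | t :: ts, q => printBlock ts
      (.push .out (fun s : S.Reg => (some (S.bits s.1 (s.2.2.getD default) t) : Option Bool)) q)

/-- The program of the Turing machine. -/
def program : Label → S.Stmt
  | .read => .pop .inp (fun s (x : Option (Option Bool)) => (s.1, x, s.2.2))
      (.branch (fun s => s.2.1.isSome)
        (.push .right (fun s => S.readCell s.1 (s.2.1.getD none))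
          (.load (fun s => (S.readState s.1 (s.2.1.getD none), s.2)) (.goto fun _ => .read)))
        (.load (fun s => (S.turn s.1, s.2)) (.goto fun _ => .back)))
  | .back => .pop .right (fun s (x : Option S.Cell) => (s.1, s.2.1, x))
      (.branch (fun s => s.2.2.isSome)
        (.push .left (fun s => (s.2.2.getD default : S.Cell)) (.goto fun _ => .back))
        (.branch (fun s => S.alive s.1)
          (.push .out (fun _ => (none : Option Bool)) (.goto fun _ => .forth))
          (.goto fun _ => .clean)))
  | .forth => .pop .left (fun s (x : Option S.Cell) => (s.1, s.2.1, x))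
      (.branch (fun s => s.2.2.isSome)
        (.push .right (fun s => S.write s.1 (s.2.2.getD default))
          (S.printBlock (List.finRange _)
            (.load (fun s => (S.next s.1 (s.2.2.getD default), s.2)) (.goto fun _ => .forth))))
        (.load (fun s => (S.turn s.1, s.2)) (.goto fun _ => .back)))
  | .clean => .pop .left (fun s (x : Option S.Cell) => (s.1, s.2.1, x))
      (.branch (fun s => s.2.2.isSome) (.goto fun _ => .clean)
        (.load (fun _ => (S.init, none, none)) .halt))

/-- The Turing machine that simulates a sweeping machine. -/
noncomputable def machine : Turing.FinTM2 where
  K := Stack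
  k₀ := .inp
  k₁ := .out
  Γ := S.Alphabet
  Λ := Label
  main := .read
  σ := S.Reg
  initialState := (S.init, none, none)
  σFin := Fintype.ofFinite _
  Γk₀Fin := inferInstanceAs (Fintype (Option Bool))
  m := S.program

variable {S}

/-- The contents of the tapes. -/
def tapes (i : List (Option Bool)) (a b : List S.Cell) (o : List (Option Bool)) :
    ∀ k, List (S.Alphabet k)
  | .inp => i
  | .left => a
  | .right => b
  | .out => o

lemma initList_machine (w : List (Option Bool)) :
    Turing.initList S.machine (w.map (Equiv.refl (Option Bool)).invFun) =
      ⟨some .read, (S.init, none, none), tapes w [] [] []⟩ := by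
  refine congrArg (Turing.TM2.Cfg.mk _ _) (funext fun k => ?_)
  cases k with
  | inp => exact List.map_id w
  | left | right | out => rfl

lemma haltList_machine (o : List (Option Bool)) :
    Turing.haltList S.machine (o.map (Equiv.refl (Option Bool)).invFun) =
      ⟨none, (S.init, none, none), tapes [] [] [] o⟩ := by
  refine congrArg (Turing.TM2.Cfg.mk _ _) (funext fun k => ?_)
  cases k with
  | out => exact List.map_id o
  | inp | left | right => rfl

/-- The Turing machine goes from one configuration to another one in exactly `k` steps. -/
def StepsTo (k : ℕ) (x y : S.Cfg) : Prop :=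
  (flip bind (Turing.TM2.step S.program))^[k] (some x) = some y

lemma StepsTo.trans {k l : ℕ} {x y z : S.Cfg} (h : StepsTo k x y) (h' : StepsTo l y z) :
    StepsTo (k + l) x z := by
  unfold StepsTo at *
  rw [Nat.add_comm, Function.iterate_add_apply, h, h']

lemma StepsTo.single {l : Label} {l' : Option Label} {s s' : S.Reg}
    {T U T' : ∀ k, List (S.Alphabet k)}
    (h : Turing.TM2.stepAux (S.program l) s T = ⟨l', s', U⟩) (hU : ∀ k, U k = T' k) :
    StepsTo 1 ⟨some l, s, T⟩ ⟨l', s', T'⟩ := by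
  obtain rfl := funext hU
  exact congrArg some h

lemma stepAux_printBlock (ts : List (Fin S.width)) (q : S.Stmt) (s : S.Reg)
    {T : ∀ k, List (S.Alphabet k)} {o : List (Option Bool)} (hT : T .out = o) :
    Turing.TM2.stepAux (S.printBlock ts q) s T = Turing.TM2.stepAux q s (Function.update T .out
      ((ts.map fun t => some (S.bits s.1 (s.2.2.getD default) t)) ++ o)) := by
  subst hT
  induction ts generalizing q with
  | nil => exact congrArg _ (Function.update_eq_self _ _).symm
  | cons t ts ih =>
    refine (ih _).trans (congrArg (Turing.TM2.stepAux q s) ?_)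
    exact (Function.update_idem _ _ _).trans (congrArg _ (congrArg _ (Function.update_self _ _ _)))

lemma stepsTo_read (w : List (Option Bool)) (q : S.State) (x : Option (Option Bool))
    (y : Option S.Cell) (b : List S.Cell) :
    StepsTo (w.length + 1) ⟨some .read, (q, x, y), tapes w [] b []⟩
      ⟨some .back, (S.turn (w.foldl S.readState q), none, y),
        tapes [] [] ((sweepMap S.readState S.readCell q w).reverse ++ b) []⟩ := by
  induction w generalizing q x b with
  | nil => exact .single rfl (by rintro (_ | _ | _ | _) <;> rfl)
  | cons c w ih =>
    have h : StepsTo 1 ⟨some .read, (q, x, y), tapes (c :: w) [] b []⟩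
        ⟨some .read, (S.readState q c, some c, y), tapes w [] (S.readCell q c :: b) []⟩ :=
      .single rfl (by rintro (_ | _ | _ | _) <;> rfl)
    rw [List.length_cons, Nat.add_comm _ 1]
    simpa [sweepMap] using h.trans (ih (S.readState q c) (some c) (S.readCell q c :: b))

lemma stepsTo_back (q : S.State) (x : Option (Option Bool)) (y : Option S.Cell)
    (a b : List S.Cell) (o : List (Option Bool)) :
    StepsTo (b.length + 1) ⟨some .back, (q, x, y), tapes [] a b o⟩
      (if S.alive q then ⟨some .forth, (q, x, none), tapes [] (b.reverse ++ a) [] (none :: o)⟩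
      else ⟨some .clean, (q, x, none), tapes [] (b.reverse ++ a) [] o⟩) := by
  induction b generalizing y a with
  | nil =>
    cases hq : S.alive q
    · exact .single ((congrArg (cond · _ _) hq).trans rfl) (by rintro (_ | _ | _ | _) <;> rfl)
    · exact .single ((congrArg (cond · _ _) hq).trans rfl) (by rintro (_ | _ | _ | _) <;> rfl)
  | cons c b ih =>
    have h : StepsTo 1 ⟨some .back, (q, x, y), tapes [] a (c :: b) o⟩
        ⟨some .back, (q, x, some c), tapes [] (c :: a) b o⟩ :=
      .single rfl (by rintro (_ | _ | _ | _) <;> rfl)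
    rw [List.length_cons, Nat.add_comm _ 1]
    simpa using h.trans (ih (some c) (c :: a))

lemma stepsTo_forth (q : S.State) (x : Option (Option Bool)) (y : Option S.Cell)
    (a b : List S.Cell) (o : List (Option Bool)) :
    StepsTo (a.length + 1) ⟨some .forth, (q, x, y), tapes [] a b o⟩
      ⟨some .back, (S.turn (a.foldl S.next q), x, none),
        tapes [] [] ((sweepMap S.next S.write q a).reverse ++ b)
          ((sweepMap S.next S.block q a).reverse.flatten ++ o)⟩ := by
  induction a generalizing q y b o with
  | nil => exact .single rfl (by rintro (_ | _ | _ | _) <;> rfl)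
  | cons c a ih =>
    have h : StepsTo 1 ⟨some .forth, (q, x, y), tapes [] (c :: a) b o⟩
        ⟨some .forth, (S.next q c, x, some c),
          tapes [] a (S.write q c :: b) (S.block q c ++ o)⟩ :=
      .single ((stepAux_printBlock _ _ _ rfl).trans rfl) (by rintro (_ | _ | _ | _) <;> rfl)
    rw [List.length_cons, Nat.add_comm _ 1]
    simpa [sweepMap] using h.trans (ih (S.next q c) (some c) (S.write q c :: b) (S.block q c ++ o))

lemma stepsTo_clean (q : S.State) (x : Option (Option Bool)) (y : Option S.Cell) (a : List S.Cell)
    (o : List (Option Bool)) :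
    StepsTo (a.length + 1) ⟨some .clean, (q, x, y), tapes [] a [] o⟩
      ⟨none, (S.init, none, none), tapes [] [] [] o⟩ := by
  induction a generalizing y with
  | nil => exact .single rfl (by rintro (_ | _ | _ | _) <;> rfl)
  | cons c a ih =>
    have h : StepsTo 1 ⟨some .clean, (q, x, y), tapes [] (c :: a) [] o⟩
        ⟨some .clean, (q, x, some c), tapes [] a [] o⟩ :=
      .single rfl (by rintro (_ | _ | _ | _) <;> rfl)
    rw [List.length_cons, Nat.add_comm _ 1]
    exact h.trans (ih (some c))

lemma stepsTo_sweepsTo {k : ℕ} {x y : S.Conf} (h : S.SweepsTo k x y) (hy : S.alive y.1 = false)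
    (a : Option (Option Bool)) (b : Option S.Cell) :
    StepsTo ((2 * k + 2) * (x.2.1.length + 1))
      ⟨some .back, (x.1, a, b), tapes [] [] x.2.1.reverse x.2.2⟩
      ⟨none, (S.init, none, none), tapes [] [] [] y.2.2⟩ := by
  have back (x : S.Conf) (b : Option S.Cell) := stepsTo_back x.1 a b [] x.2.1.reverse x.2.2
  simp only [List.reverse_reverse, List.length_reverse, List.append_nil] at back
  induction k generalizing x b with
  | zero =>
    obtain rfl : x = y := h
    have backward := back x b
    rw [if_neg (by simp [hy])] at backward
    simpa only [mul_zero, zero_add, two_mul] using backward.trans (stepsTo_clean _ _ _ _ _)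
  | succ k ih =>
    have backward := back x b
    rw [if_pos h.1] at backward
    have forward := stepsTo_forth x.1 a none x.2.1 [] (none :: x.2.2)
    rw [List.append_nil] at forward
    have rest := ih h.2 none
    rw [show (S.sweep x).2.1.length = x.2.1.length from length_sweepMap _ _ _ _] at rest
    convert (backward.trans forward).trans rest using 1
    ring

end Program

theorem computableInPolyTime (S : SweepMachine) {α β : Type} {ea : α → List (Option Bool)}
    {eb : β → List (Option Bool)} {f : α → β} (k : α → ℕ) (C : ℕ)
    (hk : ∀ a, k a ≤ C * (ea a).length)
    (h : ∀ a, ∃ y, S.SweepsTo (k a) (S.start (ea a)) y ∧ S.alive y.1 = false ∧ y.2.2 = eb (f a)) :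
    Nonempty (Turing.TM2ComputableInPolyTime ea eb f) := by
  refine ⟨{
    tm := S.machine
    inputAlphabet := Equiv.refl _
    outputAlphabet := Equiv.refl _
    time := (2 * Polynomial.C C * Polynomial.X + 3) * (Polynomial.X + 1)
    outputsFun := fun a => {
      steps := ((ea a).length + 1) + (2 * k a + 2) * ((ea a).length + 1)
      evals_in_steps := ?_
      steps_le_m := ?_ } }⟩
  · obtain ⟨y, hy, hdead, hout⟩ := h a
    have read := stepsTo_read (S := S) (ea a) S.init none none []
    rw [List.append_nil] at read
    have run := read.trans (stepsTo_sweepsTo hy hdead none none)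
    rw [hout, show (S.start (ea a)).2.1.length = (ea a).length from length_sweepMap _ _ _ _] at run
    exact (congrArg (fun x => (flip bind S.machine.step)^[_] (some x)) (initList_machine _)).trans
      (Eq.trans run (congrArg some (haltList_machine _)).symm)
  · have := hk a
    simp only [Polynomial.eval_mul, Polynomial.eval_add, Polynomial.eval_X, Polynomial.eval_one,
      Polynomial.eval_C, Polynomial.eval_ofNat]
    nlinarith [this, Nat.zero_le (ea a).length]

end SweepMachine

/-! ### Printing the adjacency matrix of a gadget graph -/

section Positions

variable {n : ℕ}

/-- The position after `p` in a table with `n` rows and the columns `0, …, n`. The position after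
the last one is `(n, 0)`. -/
def nextPosition (n : ℕ) (p : ℕ × ℕ) : ℕ × ℕ :=
  if p.2 = n then (p.1 + 1, 0) else (p.1, p.2 + 1)

/-- The positions of a table with `n` rows and the columns `0, …, n`. -/
def gridPositions (n : ℕ) : List (ℕ × ℕ) :=
  List.range n ×ˢ List.range (n + 1)

lemma mem_gridPositions {p : ℕ × ℕ} : p ∈ gridPositions n ↔ p.1 < n ∧ p.2 ≤ n := by
  obtain ⟨i, j⟩ := p
  simp [gridPositions]

lemma iterate_nextPosition_row (i : ℕ) : (nextPosition n)^[n + 1] (i, 0) = (i + 1, 0) := by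
  have iterate_of_le (k : ℕ) (hk : k ≤ n) : (nextPosition n)^[k] (i, 0) = (i, k) := by
    induction k with
    | zero => rfl
    | succ k ih =>
      rw [Function.iterate_succ_apply', ih (by omega), nextPosition, if_neg (by simp; omega)]
  rw [Function.iterate_succ_apply', iterate_of_le n le_rfl, nextPosition, if_pos rfl]

lemma iterate_nextPosition_rows (i : ℕ) :
    (nextPosition n)^[i * (n + 1)] (0, 0) = (i, 0) := by
  induction i with
  | zero => simp
  | succ i ih =>
    rw [Nat.succ_mul, Nat.add_comm, Function.iterate_add_apply, ih, iterate_nextPosition_row]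

lemma listIterate_nextPosition_row (i j k : ℕ) (h : j + k = n + 1) :
    List.iterate (nextPosition n) (i, j) k = (List.range' j k).map (Prod.mk i) := by
  induction k generalizing j with
  | zero => rfl
  | succ k ih =>
    rw [List.iterate, List.range'_succ, List.map_cons]
    rcases k with _ | k
    · rfl
    · rw [nextPosition, if_neg (by simp; omega), ih _ (by omega)]

lemma listIterate_nextPosition (n : ℕ) :
    List.iterate (nextPosition n) (0, 0) (n * (n + 1)) = gridPositions n := by
  suffices ∀ i, List.iterate (nextPosition n) (0, 0) (i * (n + 1)) =
      List.range i ×ˢ List.range (n + 1) from this n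
  intro i
  induction i with
  | zero => simp
  | succ i ih =>
    rw [Nat.succ_mul, List.iterate_add, ih, iterate_nextPosition_rows,
      listIterate_nextPosition_row _ _ _ (Nat.zero_add _), List.range_succ (n := i),
      ← List.range_eq_range']
    exact (List.flatMap_append.trans (congrArg _ (List.flatMap_singleton ..))).symm

end Positions

section Marks

/-- An input symbol at a position `(i', j')` with marks that compare this position to the current
position `(i, j)`. -/
structure MarkCell : Type where
  symbol : Option Bool
  /-- Whether `i' = i`. -/
  sameRow : Bool
  /-- Whether `j' = j`. -/
  sameCol : Bool
  /-- Whether `i' = j`. -/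
  colRow : Bool
  /-- Whether `j' = i`. -/
  rowCol : Bool
  deriving Inhabited

/-- The state of the machine that prints adjacency matrices of gadget graphs. During a sweep it
remembers marks of the cells it has passed, because the marks relative to the next position are
those relative to the current one, moved by one cell, or by one row at the end of a row. -/
structure MarkState (m : ℕ) : Type where
  /-- The kind of the vertex whose row is printed. -/
  kind : Fin (m + 1)
  /-- The symbol at the current position, or `none` after the last position. -/
  symbol : Option (Option Bool)
  /-- The symbol at the next position, once it has been seen. -/
  nextSymbol : Option (Option Bool)
  /-- The mark `sameCol` of the previous cell; the last column precedes the first one. -/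
  prevSameCol : Bool
  /-- The mark `rowCol` of the previous cell. -/
  prevRowCol : Bool
  /-- The mark `sameRow` of the previous row. -/
  prevSameRow : Bool
  /-- The mark `colRow` of the previous row; for the first row, whether the current position is in
  the last column. -/
  prevColRow : Bool

instance : Finite MarkCell :=
  Finite.of_injective
      (fun c : MarkCell => (c.symbol, c.sameRow, c.sameCol, c.colRow, c.rowCol)) <| by
    rintro ⟨⟩ ⟨⟩ h
    simpa using h

instance (m : ℕ) : Finite (MarkState m) :=
  Finite.of_injective (fun q : MarkState m => (q.kind, q.symbol, q.nextSymbol, q.prevSameCol,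
    q.prevRowCol, q.prevSameRow, q.prevColRow)) <| by
    rintro ⟨⟩ ⟨⟩ h
    simpa using h

variable {m : ℕ}

/-- The state at the beginning of a sweep. -/
def MarkState.initial (k : Fin (m + 1)) (a : Option (Option Bool)) : MarkState m where
  kind := k
  symbol := a
  nextSymbol := none
  prevSameCol := decide (a = some none)
  prevRowCol := false
  prevSameRow := false
  prevColRow := decide (a = some none)

/-- The marks of a cell relative to the next position. The symbol `some none` marks the end of a
row. -/
def MarkState.shift (q : MarkState m) (c : MarkCell) : MarkCell where
  symbol := c.symbol
  sameRow := if q.symbol = some none then q.prevSameRow else c.sameRow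
  sameCol := q.prevSameCol
  colRow := q.prevColRow
  rowCol := if q.symbol = some none then q.prevRowCol else c.rowCol

/-- The flags of the current cell, with symbol `a`, and the cell `c`. -/
def MarkCell.flags (c : MarkCell) (a : Option Bool) : CellFlags :=
  ⟨a, c.symbol, c.sameRow, c.sameCol, c.colRow, c.rowCol⟩

/-- The machine that prints adjacency matrices of gadget graphs, with `F k k'` the adjacency of
vertices of the kinds `k` and `k'`. For each position, it does a sweep for each of the kinds, from
the last one down to `0`; the last of these sweeps moves the marks to the next position. While the
input is read, the marks in the state are those of the upcoming cell relative to `(0, 0)`. -/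
def markMachine (F : Fin (m + 1) → Fin (m + 1) → CellFlags → Bool) : SweepMachine where
  State := MarkState m
  Cell := MarkCell
  width := m + 1
  init := ⟨0, none, none, true, false, true, false⟩
  readState q a := { q with
    prevSameCol := decide (a = none)
    prevSameRow := q.prevSameRow && decide (a ≠ none)
    nextSymbol := if q.prevSameRow && q.prevSameCol then some a else q.nextSymbol }
  readCell q a := ⟨a, q.prevSameRow, q.prevSameCol, q.prevSameRow, q.prevSameCol⟩
  alive q := q.symbol.isSome
  next q c := { q with
    nextSymbol := if (q.shift c).sameRow && (q.shift c).sameCol then some c.symbol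
      else q.nextSymbol
    prevSameCol := c.sameCol
    prevRowCol := c.rowCol
    prevSameRow := if c.symbol = none then c.sameRow else q.prevSameRow
    prevColRow := if c.symbol = none then c.colRow else q.prevColRow }
  write q c := if q.kind = 0 then q.shift c else c
  bits q c k := F q.kind k (c.flags (q.symbol.getD none))
  turn q := if q.kind = 0 then .initial (Fin.last m) q.nextSymbol
    else .initial (q.kind - 1) q.symbol

variable {n : ℕ} (s : ℕ × ℕ → Option Bool)

/-- The cell at the position `q` when the current position is `p`. -/
def markCell (p q : ℕ × ℕ) : MarkCell :=
  ⟨s q, decide (q.1 = p.1), decide (q.2 = p.2), decide (q.1 = p.2), decide (q.2 = p.1)⟩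

/-- The state upon reaching the position `q` in a sweep for the kind `k` and the current
position `p`. -/
def markState (n : ℕ) (k : Fin (m + 1)) (p q : ℕ × ℕ) : MarkState m where
  kind := k
  symbol := some (s p)
  nextSymbol := if (nextPosition n p).1 < q.1 ∨ (nextPosition n p).1 = q.1 ∧
    (nextPosition n p).2 < q.2 then some (s (nextPosition n p)) else none
  prevSameCol := if q.2 = 0 then decide (p.2 = n) else decide (q.2 - 1 = p.2)
  prevRowCol := if q.2 = 0 then false else decide (q.2 - 1 = p.1)
  prevSameRow := decide (q.1 = p.1 + 1)
  prevColRow := if q.1 = 0 then decide (p.2 = n) else decide (q.1 - 1 = p.2)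

/-- The configuration at the beginning of the sweep for the kind `k` and the position `p`, with
output `o`. -/
def markConf (F : Fin (m + 1) → Fin (m + 1) → CellFlags → Bool) (n : ℕ) (k : Fin (m + 1))
    (p : ℕ × ℕ) (o : List (Option Bool)) : (markMachine F).Conf :=
  (.initial k (if p.1 < n then some (s p) else none), (gridPositions n).map (markCell s p), o)

/-- The row of the adjacency matrix for the vertex of kind `k` at the position `p`. -/
def markRow (F : Fin (m + 1) → Fin (m + 1) → CellFlags → Bool) (n : ℕ) (p : ℕ × ℕ)
    (k : Fin (m + 1)) : List (Option Bool) :=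
  ((gridPositions n).map fun q => (List.finRange (m + 1)).map fun k' =>
    some (F k k' ((markCell s p q).flags (s p)))).reverse.flatten ++ [none]

/-- The rows of the adjacency matrix for all the vertices at the position `p`. -/
def markRows (F : Fin (m + 1) → Fin (m + 1) → CellFlags → Bool) (n : ℕ) (p : ℕ × ℕ) :
    List (Option Bool) :=
  (List.finRange (m + 1)).flatMap (markRow s F n p)

variable {s} (F : Fin (m + 1) → Fin (m + 1) → CellFlags → Bool) (k : Fin (m + 1)) {p q : ℕ × ℕ}
  (hs : ∀ p ∈ gridPositions n, s p = none ↔ p.2 = n)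
include hs

lemma start_markMachine :
    (markMachine F).start ((gridPositions n).map s) = markConf s F n (Fin.last m) (0, 0) [] := by
  let st (p : ℕ × ℕ) : MarkState m :=
    ⟨0, none, if 0 < p.1 ∨ 0 < p.2 then some (s (0, 0)) else none, decide (p.2 = 0), false,
      decide (p.1 = 0), false⟩
  have step (p) (hp : p ∈ List.iterate (nextPosition n) (0, 0) (n * (n + 1))) :
      (markMachine F).readState (st p) (s p) = st (nextPosition n p) := by
    rw [listIterate_nextPosition] at hp
    have hsp := hs p hp
    obtain ⟨i, j⟩ := p
    by_cases hi : i = 0 <;> by_cases hj : j = 0 <;> by_cases hjn : j = n <;>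
      simp_all [st, markMachine, nextPosition, Nat.pos_iff_ne_zero]
  have key := SweepMachine.start_map_iterate rfl step
  rw [listIterate_nextPosition, iterate_nextPosition_rows] at key
  refine key.trans ?_
  simp [markConf, markCell, markMachine, st]

lemma shift_markState (hp : p ∈ gridPositions n) (hq : q ∈ gridPositions n) :
    (markState s n k p q).shift (markCell s p q) = markCell s (nextPosition n p) q := by
  have hsp := hs p hp
  rw [mem_gridPositions] at hp hq
  simp only [MarkState.shift, markState, markCell, Option.some.injEq, hsp, nextPosition,
    MarkCell.mk.injEq, true_and]
  refine ⟨?_, ?_, ?_, ?_⟩ <;> split_ifs <;> simp <;> omega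

lemma next_markState (hp : p ∈ gridPositions n) (hq : q ∈ gridPositions n) :
    (markMachine F).next (markState s n k p q) (markCell s p q) =
      markState s n k p (nextPosition n q) := by
  have hsq := hs q hq
  have hshift := shift_markState k hs hp hq
  rw [mem_gridPositions] at hp hq
  have passed : (nextPosition n p).1 < (nextPosition n q).1 ∨
      (nextPosition n p).1 = (nextPosition n q).1 ∧ (nextPosition n p).2 < (nextPosition n q).2 ↔
      q = nextPosition n p ∨ (nextPosition n p).1 < q.1 ∨
        (nextPosition n p).1 = q.1 ∧ (nextPosition n p).2 < q.2 := by
    rw [Prod.ext_iff]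
    unfold nextPosition
    split_ifs <;> simp <;> omega
  simp only [markMachine, hshift]
  simp only [markState, markCell, hsq, MarkState.mk.injEq, true_and, Bool.and_eq_true,
    decide_eq_true_eq, ← Prod.ext_iff, passed]
  refine ⟨?_, ?_, ?_, ?_, ?_⟩
  · by_cases h : q = nextPosition n p
    · rw [if_pos h, if_pos (.inl h), h]
    · simp only [h, if_false, false_or]
  all_goals by_cases hqn : q.2 = n <;> simp [nextPosition, hqn] <;> omega

lemma initial_eq_markState (hp : p ∈ gridPositions n) :
    MarkState.initial k (if p.1 < n then some (s p) else none) = markState s n k p (0, 0) := by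
  have hsp := hs p hp
  rw [mem_gridPositions] at hp
  simp [MarkState.initial, markState, hp.1, hsp]

lemma sweep_markMachine (hp : p ∈ gridPositions n) (o : List (Option Bool)) :
    (markMachine F).sweep (markConf s F n k p o) =
      (if k = 0 then markConf s F n (Fin.last m) (nextPosition n p) else markConf s F n (k - 1) p)
        (markRow s F n p k ++ o) := by
  have step (q) (hq : q ∈ List.iterate (nextPosition n) (0, 0) (n * (n + 1))) :=
    next_markState F k hs hp (listIterate_nextPosition n ▸ hq)
  have key := SweepMachine.sweep_map_iterate step o
  rw [listIterate_nextPosition, iterate_nextPosition_rows,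
    ← initial_eq_markState k hs hp] at key
  refine key.trans ?_
  have cells : ((gridPositions n).map fun q =>
      (markMachine F).write (markState s n k p q) (markCell s p q)) =
        (gridPositions n).map (markCell s (if k = 0 then nextPosition n p else p)) := by
    refine List.map_congr_left fun q hq => ?_
    refine (if_congr Iff.rfl (shift_markState k hs hp hq) rfl).trans ?_
    exact (apply_ite (markCell s · q) _ _ _).symm
  have state : (markMachine F).turn (markState s n k p (n, 0)) =
      (if k = 0 then markConf s F n (Fin.last m) (nextPosition n p) o
        else markConf s F n (k - 1) p o).1 := by
    rw [apply_ite Prod.fst]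
    simp [markMachine, markState, markConf, (mem_gridPositions.1 hp).1]
  rw [cells, state, markRow, List.append_assoc]
  split_ifs <;> rfl

lemma sweepsTo_position (hp : p ∈ gridPositions n) (o : List (Option Bool)) :
    (markMachine F).SweepsTo (m + 1) (markConf s F n (Fin.last m) p o)
      (markConf s F n (Fin.last m) (nextPosition n p) (markRows s F n p ++ o)) := by
  have alive (k o) : (markMachine F).alive (markConf s F n k p o).1 = true := by
    simp [markMachine, markConf, (mem_gridPositions.1 hp).1, MarkState.initial]
  have countdown (k : Fin (m + 1)) : ∀ o, (markMachine F).SweepsTo (k + 1) (markConf s F n k p o)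
      (markConf s F n (Fin.last m) (nextPosition n p)
        (((List.finRange (m + 1)).take (k + 1)).flatMap (markRow s F n p) ++ o)) := by
    induction k using Fin.induction with
    | zero =>
      intro o
      refine .single (alive _ _) ?_
      rw [sweep_markMachine F 0 hs hp, if_pos rfl]
      simp [List.take_succ_eq_append_getElem]
    | succ k ih =>
      intro o
      have pred : k.succ - 1 = k.castSucc := by
        rw [sub_eq_iff_eq_add, Fin.coeSucc_eq_succ]
      have first := sweep_markMachine F k.succ hs hp o
      rw [if_neg k.succ_ne_zero, pred] at first
      have all := (SweepMachine.SweepsTo.single (alive _ _) first).trans (ih _)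
      rw [Nat.add_comm] at all
      rw [List.take_succ_eq_append_getElem (i := k.succ) (by simp)]
      simpa [Fin.succ] using all
  have all := countdown (Fin.last m) o
  rwa [List.take_of_length_le (by simp)] at all

lemma sweepsTo_all :
    (markMachine F).SweepsTo ((m + 1) * (n * (n + 1))) (markConf s F n (Fin.last m) (0, 0) [])
      (markConf s F n (Fin.last m) (n, 0)
        ((gridPositions n).map (markRows s F n)).reverse.flatten) := by
  have all := SweepMachine.SweepsTo.iterate (p := (0, 0))
    (conf := markConf s F n (Fin.last m)) (k := n * (n + 1))
    (fun p hp => sweepsTo_position F hs (listIterate_nextPosition n ▸ hp)) []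
  rwa [listIterate_nextPosition, iterate_nextPosition_rows, List.append_nil] at all

end Marks

/-! ### The encoding and its computation -/

section Encoding

variable {n r m : ℕ}

/-- The cells of a table, in the order of the encoding of graphs. -/
def gridCells (n : ℕ) : List (GridCell n) :=
  List.finRange n ×ˢ ((List.finRange n).map some ++ [none])

/-- The position of a cell in a table. -/
def cellPosition (c : GridCell n) : ℕ × ℕ := (c.1, c.2.elim n Fin.val)

lemma mem_gridCells (c : GridCell n) : c ∈ gridCells n := by
  rcases c with ⟨i, _ | j⟩ <;> simp [gridCells]

lemma nodup_gridCells (n : ℕ) : (gridCells n).Nodup :=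
  (List.nodup_finRange n).product <| List.nodup_append.2
    ⟨(List.nodup_finRange n).map (Option.some_injective _), List.nodup_singleton _, by simp⟩

lemma gridPositions_eq_map (n : ℕ) : gridPositions n = (gridCells n).map cellPosition := by
  have columns : List.range (n + 1) =
      ((List.finRange n).map some ++ [none]).map fun o : Option (Fin n) => o.elim n Fin.val := by
    simp [List.range_succ, ← List.map_coe_finRange_eq_range, Function.comp_def]
  change (List.range n).flatMap _ = ((List.finRange n).flatMap _).map _
  rw [columns, ← List.map_coe_finRange_eq_range, List.flatMap_map, List.map_flatMap]
  simp only [List.map_map]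
  rfl

open Classical in
/-- The symbol of the encoding of a graph at a position. -/
noncomputable def graphSymbol (H : SimpleGraph (Fin n)) (p : ℕ × ℕ) : Option Bool :=
  if h : p.1 < n ∧ p.2 < n then some (decide (H.Adj ⟨p.1, h.1⟩ ⟨p.2, h.2⟩)) else none

lemma graphSymbol_cellPosition (H : SimpleGraph (Fin n)) (c : GridCell n) :
    graphSymbol H (cellPosition c) = cellSymbol H c := by
  rcases c with ⟨i, _ | j⟩
  · simp [graphSymbol, cellPosition, cellSymbol]
  · exact dif_pos ⟨i.2, j.2⟩

lemma graphSymbol_eq_none_iff (H : SimpleGraph (Fin n)) {p : ℕ × ℕ} (hp : p ∈ gridPositions n) :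
    graphSymbol H p = none ↔ p.2 = n := by
  rw [mem_gridPositions] at hp
  unfold graphSymbol
  split_ifs <;> simp <;> omega

lemma encodeGraph_eq_map (H : FinGraph) :
    encodeGraph H = (gridPositions H.1).map (graphSymbol H.2) := by
  rw [gridPositions_eq_map, List.map_map]
  simp only [Function.comp_def, graphSymbol_cellPosition]
  change _ = ((List.finRange H.1).flatMap _).map _
  rw [List.map_flatMap]
  simp [encodeGraph, cellSymbol, Function.comp_def]

lemma flags_markCell (H : SimpleGraph (Fin n)) (c d : GridCell n) :
    (markCell (graphSymbol H) (cellPosition c) (cellPosition d)).flags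
      (graphSymbol H (cellPosition c)) = cellFlags H c d := by
  simp only [MarkCell.flags, markCell, graphSymbol_cellPosition, cellFlags, CellFlags.mk.injEq,
    true_and, decide_eq_decide]
  rcases c with ⟨i, _ | j⟩ <;> rcases d with ⟨i', _ | j'⟩ <;>
    simp [cellPosition, Fin.ext_iff] <;> omega

variable (κ : GadgetKind r ≃ Fin (m + 1))

/-- The vertices of the gadget graph. As later output comes first, the order of the cells is
reversed. -/
def gadgetVertices (n : ℕ) : List (GridCell n × GadgetKind r) :=
  (gridCells n).reverse ×ˢ (List.finRange (m + 1)).map κ.symm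

lemma mem_gadgetVertices (u : GridCell n × GadgetKind r) : u ∈ gadgetVertices κ n := by
  refine List.mem_product.2 ⟨List.mem_reverse.2 (mem_gridCells _), List.mem_map.2 ?_⟩
  exact ⟨κ u.2, List.mem_finRange _, κ.symm_apply_apply _⟩

lemma nodup_gadgetVertices (n : ℕ) : (gadgetVertices κ n).Nodup :=
  (List.nodup_reverse.2 (nodup_gridCells n)).product
    ((List.nodup_finRange _).map κ.symm.injective)

open Classical in
lemma encodeGraph_comap_get {V : Type} (l : List V) (G : SimpleGraph V) :
    encodeGraph ⟨l.length, G.comap l.get⟩ =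
      l.flatMap fun u => l.map (fun v => some (decide (G.Adj u v))) ++ [none] := by
  conv_rhs => rw [← List.map_get_finRange l]
  rw [List.flatMap_map]
  simp only [List.map_map]
  rfl

variable [NeZero r] (R : Set (Sym2 (Fin (r + 2))))

/-- The gadget graph with its vertices numbered by their positions in `gadgetVertices`. -/
noncomputable def gadgetFinGraph (H : FinGraph) : FinGraph :=
  ⟨(gadgetVertices κ H.1).length, (gadgetGraph R H.2).comap (gadgetVertices κ H.1).get⟩

/-- The numbering of the vertices of the gadget graph. -/
noncomputable def gadgetIso (H : FinGraph) : (gadgetFinGraph κ R H).2 ≃g gadgetGraph R H.2 where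
  toEquiv := Equiv.ofBijective (gadgetVertices κ H.1).get
    ⟨(nodup_gadgetVertices κ H.1).injective_get, fun u =>
      List.mem_iff_get.1 (mem_gadgetVertices κ u)⟩
  map_rel_iff' := Iff.rfl

lemma card_gadgetFinGraph (H : FinGraph) :
    (gadgetFinGraph κ R H).1 = H.1 * (H.1 + 1) * (m + 1) := by
  have card := Nat.card_congr (gadgetIso κ R H).toEquiv
  rw [Nat.card_prod, Nat.card_congr κ, Nat.card_prod] at card
  simpa using card

open Classical in
/-- Whether gadget vertices whose kinds have the given numbers are adjacent. -/
noncomputable def gadgetBit (k k' : Fin (m + 1)) (x : CellFlags) : Bool :=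
  decide ((κ.symm k).Linked R (κ.symm k') x)

lemma encodeGraph_gadgetFinGraph (H : FinGraph) :
    encodeGraph (gadgetFinGraph κ R H) =
      ((gridPositions H.1).map
        (markRows (graphSymbol H.2) (gadgetBit κ R) H.1)).reverse.flatten := by
  classical
  have row (c : GridCell H.1) (k : Fin (m + 1)) :
      (gadgetVertices κ H.1).map (fun v =>
        some (decide ((gadgetGraph R H.2).Adj (c, κ.symm k) v))) ++ [none] =
        markRow (graphSymbol H.2) (gadgetBit κ R) H.1 (cellPosition c) k := by
    rw [markRow, gridPositions_eq_map, List.map_map, ← List.map_reverse, ← List.flatMap_def]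
    change ((gridCells H.1).reverse.flatMap _).map _ ++ _ = _
    rw [List.map_flatMap]
    simp only [List.map_map, Function.comp_def, gadgetGraph_adj, flags_markCell]
    rfl
  rw [gadgetFinGraph, encodeGraph_comap_get, gridPositions_eq_map, List.map_map,
    ← List.map_reverse, ← List.flatMap_def]
  change ((gridCells H.1).reverse.flatMap _).flatMap _ = _
  rw [List.flatMap_assoc]
  simp only [List.flatMap_map, row]
  rfl

lemma computable_gadgetFinGraph : Nonempty (Turing.TM2ComputableInPolyTime
    (fun H : {H : FinGraph // H ∈ (Set.univ : Set FinGraph)} => encodeGraph H.1) encodeGraph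
    fun H => gadgetFinGraph κ R H.1) := by
  refine (markMachine (gadgetBit κ R)).computableInPolyTime
    (fun H => (m + 1) * (H.1.1 * (H.1.1 + 1))) (m + 1) (fun H => ?_) fun H => ?_
  · refine Nat.mul_le_mul_left _ (le_of_eq ?_)
    simp [encodeGraph]
  · have hs (p) (hp : p ∈ gridPositions H.1.1) := graphSymbol_eq_none_iff H.1.2 hp
    have sweeps := sweepsTo_all (gadgetBit κ R) hs
    rw [← start_markMachine _ hs, ← encodeGraph_eq_map] at sweeps
    exact ⟨_, sweeps, by simp [markConf, markMachine, MarkState.initial],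
      (encodeGraph_gadgetFinGraph κ R H.1).symm⟩

end Encoding

/-! ### The interpretation -/

section Interpretation

variable {r m k : ℕ} [NeZero r] (κ : GadgetKind r ≃ Fin (m + 1)) (R : Set (Sym2 (Fin (r + 2))))

/-- The formula saying that the free variables are the hubs in an induced copy of the gadget graph
of the complete graph on `k` vertices. -/
noncomputable def hubCliqueFormula (k : ℕ) : Language.graph.Formula (Fin k) :=
  patternFormula (gadgetFinGraph κ R ⟨k, ⊤⟩).2
    fun i => (gadgetIso κ R ⟨k, ⊤⟩).symm (gadgetHub i)

lemma graphSat_hubCliqueFormula {V : Type} {G : SimpleGraph V} {x : Fin k → V} :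
    GraphSat G (hubCliqueFormula κ R k) x ↔
      ∃ e : gadgetGraph R (⊤ : SimpleGraph (Fin k)) ↪g G, ∀ i, e (gadgetHub i) = x i := by
  rw [hubCliqueFormula, graphSat_patternFormula]
  constructor
  · rintro ⟨e, he⟩
    exact ⟨(gadgetIso κ R ⟨k, ⊤⟩).symm.toRelEmbedding.trans e, he⟩
  · rintro ⟨e, he⟩
    exact ⟨(gadgetIso κ R ⟨k, ⊤⟩).toRelEmbedding.trans e, fun i => by simp [← he]⟩

lemma injective_of_graphSat_hubCliqueFormula {V : Type} {G : SimpleGraph V} {x : Fin k → V}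
    (h : GraphSat G (hubCliqueFormula κ R k) x) : x.Injective := by
  obtain ⟨e, he⟩ := (graphSat_hubCliqueFormula κ R).1 h
  simpa only [Function.comp_def, he] using e.injective.comp gadgetHub_injective

lemma graphSat_hubCliqueFormula_comp {V : Type} {G : SimpleGraph V} {x : Fin k → V}
    (h : GraphSat G (hubCliqueFormula κ R k) x) (σ : Equiv.Perm (Fin k)) :
    GraphSat G (hubCliqueFormula κ R k) (x ∘ σ) := by
  obtain ⟨e, he⟩ := (graphSat_hubCliqueFormula κ R).1 h
  exact (graphSat_hubCliqueFormula κ R).2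
    ⟨(gadgetGraphMap R (SimpleGraph.Iso.completeGraph σ).toEmbedding).trans e, fun i => he (σ i)⟩

lemma graphSat_gadgetFinGraph_iff {H : FinGraph} {x : Fin k → Fin (gadgetFinGraph κ R H).1} :
    GraphSat (gadgetFinGraph κ R H).2 (hubCliqueFormula κ R k) x ↔
      ∃ y : Fin k → Fin H.1, (∀ i, x i = (gadgetIso κ R H).symm (gadgetHub (y i))) ∧
        ∀ i j, i ≠ j → H.2.Adj (y i) (y j) := by
  let ι := gadgetIso κ R H
  rw [graphSat_hubCliqueFormula]
  constructor
  · rintro ⟨e, he⟩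
    let e' := e.trans ι.toRelEmbedding
    choose y hy using exists_map_gadgetHub e'
    refine ⟨y, fun i => ?_, fun i j hij => adj_of_map_gadgetHub e' hij (hy i) (hy j)⟩
    rw [← hy, ← he]
    exact (ι.symm_apply_apply _).symm
  · rintro ⟨y, hx, hy⟩
    have hinj : y.Injective := fun i j h => by
      by_contra hij
      exact (hy i j hij).ne h
    let e : (⊤ : SimpleGraph (Fin k)) ↪g H.2 :=
      ⟨⟨y, hinj⟩, fun {i j} => ⟨fun h hij => h.ne (congrArg y hij), hy i j⟩⟩
    exact ⟨(gadgetGraphMap R e).trans ι.symm.toRelEmbedding, fun i => (hx i).symm⟩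

/-- The interpretation of all graphs in their gadget graphs. -/
noncomputable def gadgetInterpretation : Interpretation where
  δ := hubCliqueFormula κ R 1
  φ := hubCliqueFormula κ R 2
  irrefl G u h := by
    have hub_eq : (0 : Fin 2) = 1 := injective_of_graphSat_hubCliqueFormula κ R h rfl
    exact absurd hub_eq (by decide)
  symm G u v h := by
    have swap : ![v, u] = ![u, v] ∘ Equiv.swap 0 1 := by
      ext i
      fin_cases i <;> rfl
    exact swap ▸ graphSat_hubCliqueFormula_comp κ R h _

lemma isExistential_gadgetInterpretation : (gadgetInterpretation κ R).IsExistential :=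
  ⟨isExistentialFormula_patternFormula _ _, isExistentialFormula_patternFormula _ _⟩

variable (H : FinGraph)

lemma graphSat_domain_iff (v : Fin (gadgetFinGraph κ R H).1) :
    GraphSat (gadgetFinGraph κ R H).2 (gadgetInterpretation κ R).δ ![v] ↔
      ∃ i, v = (gadgetIso κ R H).symm (gadgetHub i) := by
  refine (graphSat_gadgetFinGraph_iff κ R).trans ⟨fun ⟨y, hy, _⟩ => ⟨y 0, hy 0⟩, ?_⟩
  rintro ⟨i, rfl⟩
  exact ⟨![i], fun j => by fin_cases j; rfl, fun j j' h => (h (Subsingleton.elim j j')).elim⟩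

lemma graphSat_edge_iff (i j : Fin H.1) :
    GraphSat (gadgetFinGraph κ R H).2 (gadgetInterpretation κ R).φ
      ![(gadgetIso κ R H).symm (gadgetHub i), (gadgetIso κ R H).symm (gadgetHub j)] ↔
      H.2.Adj i j := by
  refine (graphSat_gadgetFinGraph_iff κ R).trans ⟨?_, fun hij => ⟨![i, j], ?_, ?_⟩⟩
  · rintro ⟨y, hy, hadj⟩
    have hub_injective := (gadgetIso κ R H).symm.injective.comp gadgetHub_injective
    rw [hub_injective (hy 0), hub_injective (hy 1)]
    exact hadj 0 1 (by decide)
  · exact Fin.forall_fin_two.2 ⟨rfl, rfl⟩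
  · simp [Fin.forall_fin_two, hij, hij.symm]

lemma nonempty_interpretation_iso :
    Nonempty ((gadgetInterpretation κ R).apply (gadgetFinGraph κ R H).2 ≃g H.2) := by
  let hub (i : Fin H.1) : {v // GraphSat (gadgetFinGraph κ R H).2
      (gadgetInterpretation κ R).δ ![v]} :=
    ⟨(gadgetIso κ R H).symm (gadgetHub i), (graphSat_domain_iff κ R H _).2 ⟨i, rfl⟩⟩
  have hub_bijective : hub.Bijective := by
    constructor
    · intro i j h
      exact gadgetHub_injective ((gadgetIso κ R H).symm.injective (congrArg Subtype.val h))
    · rintro ⟨v, hv⟩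
      obtain ⟨i, rfl⟩ := (graphSat_domain_iff κ R H v).1 hv
      exact ⟨i, rfl⟩
  exact ⟨RelIso.symm
    ⟨Equiv.ofBijective hub hub_bijective, fun {i j} => graphSat_edge_iff κ R H i j⟩⟩

end Interpretation

lemma exists_gadgetKind_equiv_fin (r : ℕ) : ∃ m, Nonempty (GadgetKind r ≃ Fin (m + 1)) := by
  obtain ⟨_ | m, ⟨κ⟩⟩ := Finite.exists_equiv_fin (GadgetKind r)
  · exact (κ .hub).elim0
  · exact ⟨m, ⟨κ⟩⟩

theorem mainTheorem9_general (r k : ℕ) (hr : 0 < r) (C : Set FinGraph) (hC : IsHereditary C)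
    (hflip : ∀ n : ℕ, ∃ G : SimpleGraph (BicliqueVertex r n),
      IsFlip k (subdividedBiclique r n) G ∧ ClassContains C G) :
    EffectivelyExistentiallyInterprets C Set.univ := by
  have : NeZero r := ⟨hr.ne'⟩
  obtain ⟨R, mem_of_embedding⟩ := exists_forall_layerFlip_mem hC hflip
  obtain ⟨m, ⟨κ⟩⟩ := exists_gadgetKind_equiv_fin r
  have gadget_mem (H : FinGraph) : gadgetFinGraph κ R H ∈ C :=
    mem_of_embedding (hostSize r H.1) _
      ⟨(gadgetIso κ R H).toRelEmbedding.trans (gadgetGraphEmbedding R H.2)⟩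
  refine ⟨gadgetInterpretation κ R, isExistential_gadgetInterpretation κ R,
    fun H => gadgetFinGraph κ R H.1, computable_gadgetFinGraph κ R,
    ⟨.X * (.X + 1) * .C (m + 1), fun H => ?_⟩,
    fun H => ⟨gadget_mem H.1, nonempty_interpretation_iso κ R H.1⟩⟩
  simp [card_gadgetFinGraph]

theorem mainTheorem9 (r k : ℕ) (hr : 3 ≤ r) (C : Set FinGraph) (hC : IsHereditary C)
    (hflip : ∀ n : ℕ, ∃ G : SimpleGraph (BicliqueVertex r n),
      IsFlip k (subdividedBiclique r n) G ∧ ClassContains C G) :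
    EffectivelyExistentiallyInterprets C Set.univ :=
  mainTheorem9_general r k (by omega) C hC hflip
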